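/- Let $\Bbbk$ be a commutative ring with $1$, let $Q$ be a finite quiver with vertex set $I$, and let $n\ge 1$. Let $\overline Q$ be the double of $Q$ (for each edge $a:i\to j$ of $Q$ add an edge $a^*:j\to i$; put $(a^*)^*=a$), and write $t(a),h(a)$ for the tail and head of an edge $a$ of $\overline Q$. Put $\varepsilon(a)=1$ if $a\in Q$ and $\varepsilon(a)=-1$ if $a^*\in Q$. Let $B=\bigoplus_{i\in I}\Bbbk e_i$, and write $\lambda=\sum_i\lambda_ie_i$ for $\lambda\in B$. *The algebra.* For $\lambda\in B$ and $\nu\in\Bbbk$ let $\mathscr A_{n,\lambda,\nu}$ be the following quotient of $T_{\mathscr B}\mathscr E\rtimes\Bbbk[S_n]$. Here $\mathscr B=B^{\otimes n}$ has the idempotents $|_{\underline j}=e_{j_1}\otimes\cdots\otimes e_{j_n}$, $\underline j\in I^n$; $E$ is the free $\Bbbk$-module on the edges of $\overline Q$ with its natural $B$-bimodule structure; $\mathscr E=\bigoplus_{\ell=1}^n B^{\otimes(\ell-1)}\otimes E\otimes B^{\otimes(n-\ell)}$; $a_\ell$ is the edge $a$ placed in the $\ell$-th factor; if $t(a)=j_\ell$,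 then $a_\ell(\underline j)$ is $\underline j$ with $j_\ell$ replaced by $h(a)$, and $a_\ell|_{\underline j}$ maps $|_{\underline j}$ to $|_{a_\ell(\underline j)}$. The relations are, with $s_{\ell m}$ the transposition of $\ell$ and $m$: (i) for all $\ell$ and $\underline j$, $\big(\sum_{a\in Q}[a,a^*]-\lambda\big)_\ell\big|_{\underline j}=\nu\sum_{m\ne\ell,\ j_m=j_\ell}s_{\ell m}|_{\underline j}$; (ii) for all $\ell\ne m$, $a,b\in\overline Q$ and $\underline j$ with $j_\ell=t(a)$, $j_m=t(b)$, the element $a_\ell|_{b_m(\underline j)}\,b_m|_{\underline j}-b_m|_{a_\ell(\underline j)}\,a_\ell|_{\underline j}$ equals $\nu s_{\ell m}|_{\underline j}$ if $b\in Q$ and $a=b^*$, equals $-\nu s_{\ell m}|_{\underline j}$ if $a\in Q$ and $b=a^*$, and equals $0$ otherwise. Let $\mathscr A_{n,\lambda,\nu}\text{-mod}$ be the category of all left $\mathscr A_{n,\lambda,\nu}$-modules. *The reflection.* Let $i\in I$ be a vertex without edge-loops. Define $r_i\lambda\in B$ by $(r_i\lambda)_j=\lambda_j-(\epsilon_i,\epsilon_j)\lambda_i$,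 where $(\cdot,\cdot)$ is the symmetrized Ringel form of $Q$, that is, $(\epsilon_i,\epsilon_i)=2$ and, for $j\ne i$, $-(\epsilon_i,\epsilon_j)$ is the number of edges of $Q$ between $i$ and $j$. Let $\Lambda_i$ be the set of all $(\lambda,\nu)\in B\times\Bbbk$ such that both $\lambda_i+\nu\sum_{m=2}^r s_{1m}$ and $\lambda_i-\nu\sum_{m=2}^r s_{1m}$ are invertible in $\Bbbk[S_r]$ for all $r\in\{1,\dots,n\}$. *The functor $F_i$.* Let $R=\{a\in\overline Q: h(a)=i\}$. Let $V$ be a left $\mathscr A_{n,\lambda,\nu}$-module and put $V_{\underline j}=|_{\underline j}V$. For $\underline j\in I^n$ let $\Delta(\underline j)=\{m:j_m=i\}$, and for $D\subseteq\Delta(\underline j)$ let $$V(\underline j,D)=\bigoplus_{\xi:D\to R}V_{t(\underline j,\xi)},\qquad t(\underline j,\xi)_m=t(\xi(m))\ (m\in D),\quad t(\underline j,\xi)_m=j_m\ (m\notin D).$$ A permutation $\sigma$ maps $V(\underline j,D)$ to $V(\sigma(\underline j),\sigma(D))$, carrying the $\xi$-component by $\sigma$ to the $(\xi\circ\sigma^{-1})$-component.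 For $p\in D$ let $\pi_p:V(\underline j,D)\to V(\underline j,D\setminus\{p\})$ carry the $\xi$-component by $\xi(p)_p$ to the $\xi|_{D\setminus\{p\}}$-component, and let $\mu_p:V(\underline j,D\setminus\{p\})\to V(\underline j,D)$ have the $\xi$-component $\varepsilon(\xi(p))\,\xi(p)^*_p$ applied to the $\xi|_{D\setminus\{p\}}$-component. For $r\in R$ and $\ell\in D$ let $\tau^!_{r,\ell}$ and $\tau_{r,\ell,!}$ be the projection of $V(\underline j,D)$ onto, and the inclusion into $V(\underline j,D)$ of, the sum of the components with $\xi(\ell)=r$, which is $V(r^*_\ell(\underline j),D\setminus\{\ell\})$. Set $$F_i(V)=\bigoplus_{\underline j\in I^n}V'_{\underline j},\qquad V'_{\underline j}=\bigcap_{p\in\Delta(\underline j)}\operatorname{Ker}\pi_p\subseteq V(\underline j,\Delta(\underline j))\qquad(V'_{\underline j}=V_{\underline j}\text{ if }\Delta(\underline j)=\emptyset).$$ Then $F_i(V)$ is a left $\mathscr A_{n,r_i\lambda,\nu}$-module: the idempotent $|_{\underline j}$ acts as the projection onto $V'_{\underline j}$, permutations act as above, and an edge $a$ of $\overline Q$ in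 position $\ell$ with $t(a)=j_\ell$ acts as the map $V'_{\underline j}\to V'_{a_\ell(\underline j)}$ given - if $h(a)\ne i$ and $t(a)\ne i$, by $a_\ell$ on each component; - if $t(a)=i$, by $\varepsilon(a^*)\,\tau^!_{a^*,\ell}$; - if $h(a)=i$, by $\big(-\lambda_i+\mu_\ell\pi_\ell+\nu\sum_{m\in\Delta(\underline j)}s_{m\ell}\big)\tau_{a,\ell,!}$. (If $i$ is a sink of $Q$, all the signs $\varepsilon$ that occur here are $1$; the general formulas are obtained from that case by reversing the edges of $Q$ that start at $i$.) On homomorphisms $F_i$ is given by applying the homomorphism to each component. This is the reflection functor $F_i:\mathscr A_{n,\lambda,\nu}\text{-mod}\to\mathscr A_{n,r_i\lambda,\nu}\text{-mod}$. **Statement.** If $(\lambda,\nu)\in\Lambda_i$, then the functor $F_i:\mathscr A_{n,\lambda,\nu}\text{-mod}\to\mathscr A_{n,r_i\lambda,\nu}\text{-mod}$ is exact. -/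

import Mathlib

open CategoryTheory

universe u v w uk

namespace WreathReflection

set_option linter.unusedSectionVars false
set_option linter.unusedSimpArgs false

noncomputable section

open scoped Classical

section Quiver

variable {I : Type u} [Quiver.{v} I]

/-- The edges of the double of the quiver: `Sum.inl a` is the edge `a` itself, `Sum.inr a` is the
reverse edge `a^*`. -/
abbrev DEdge (I : Type u) [Quiver.{v} I] : Type max u v :=
  Quiver.Total I ⊕ Quiver.Total I

/-- The tail `t(a)` of an edge of the double. -/
def tail : DEdge I → I
  | Sum.inl a => a.left
  | Sum.inr a => a.right

/-- The head `h(a)` of an edge of the double. -/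
def head : DEdge I → I
  | Sum.inl a => a.right
  | Sum.inr a => a.left

/-- The involution `a ↦ a^*` of the double. -/
def rev : DEdge I → DEdge I
  | Sum.inl a => Sum.inr a
  | Sum.inr a => Sum.inl a

lemma head_rev (a : DEdge I) : head (rev a) = tail a := by cases a <;> rfl
lemma tail_rev (a : DEdge I) : tail (rev a) = head a := by cases a <;> rfl

/-- The sign of an edge of the double: `1` on the edges of `Q`, `-1` on the reverse edges. -/
def sgn (k : Type uk) [CommRing k] : DEdge I → k
  | Sum.inl _ => 1
  | Sum.inr _ => -1

/-- The coefficient of `ν s_{ℓ m}` in the commutation relation of `a_ℓ` and `b_m`: it is `1` if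
`b ∈ Q` and `a = b^*`, it is `-1` if `a ∈ Q` and `b = a^*`, and it is `0` otherwise. -/
def pairing (k : Type uk) [CommRing k] (a b : DEdge I) : k :=
  if b.isLeft ∧ a = rev b then 1 else if a.isLeft ∧ b = rev a then -1 else 0

variable [Fintype I] [Fintype (Quiver.Total I)]

/-- The Ringel form of the quiver. -/
def ringelForm (α β : I → ℤ) : ℤ :=
  ∑ j, α j * β j - ∑ a : Quiver.Total I, α a.left * β a.right

/-- The symmetrized Ringel form. -/
def symForm (α β : I → ℤ) : ℤ := ringelForm α β + ringelForm β α

/-- The dual reflection `r_i` on parameters, `(r_i λ)_j = λ_j - (ε_i, ε_j) λ_i`. -/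
def reflectParam {k : Type uk} [CommRing k] (i : I) (lam : I → k) : I → k :=
  fun j => lam j - (symForm (Pi.single i 1) (Pi.single j 1) : ℤ) * lam i

end Quiver

section Algebra

variable {k : Type uk} [CommRing k] {I : Type u} [Quiver.{v} I]
  [Fintype I] [Fintype (Quiver.Total I)]

/-- Generators of `T_𝓑 𝓔 ⋊ k[S_n]`: the idempotents `|_j = e_{j_1} ⊗ ⋯ ⊗ e_{j_n}`, the edges
`a_ℓ` placed in the `ℓ`-th tensor factor, and the permutations. -/
inductive Gen (I : Type u) [Quiver.{v} I] (n : ℕ) : Type max u v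
  | vtx (j : Fin n → I) : Gen I n
  | edge (l : Fin n) (a : DEdge I) : Gen I n
  | perm (σ : Equiv.Perm (Fin n)) : Gen I n

/-- The tuple `a_ℓ(j)`: the `ℓ`-th entry is replaced by the head of `a`. -/
def move {n : ℕ} (l : Fin n) (a : DEdge I) (j : Fin n → I) : Fin n → I :=
  Function.update j l (head a)

/-- The tuple `σ(j) = (j_{σ⁻¹(1)}, …, j_{σ⁻¹(n)})`. -/
def permute {n : ℕ} {S : Type*} (σ : Equiv.Perm (Fin n)) (j : Fin n → S) : Fin n → S :=
  fun m => j (σ.symm m)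

section FreeGen

variable (k) {n : ℕ}

/-- The idempotent `|_j` in the free algebra. -/
def fV (j : Fin n → I) : FreeAlgebra k (Gen I n) := FreeAlgebra.ι k (Gen.vtx j)
/-- The edge `a_ℓ` in the free algebra; `a_ℓ |_j` is the product `fE k ℓ a * fV k j`. -/
def fE (l : Fin n) (a : DEdge I) : FreeAlgebra k (Gen I n) := FreeAlgebra.ι k (Gen.edge l a)
/-- The permutation `σ` in the free algebra. -/
def fS (σ : Equiv.Perm (Fin n)) : FreeAlgebra k (Gen I n) := FreeAlgebra.ι k (Gen.perm σ)

end FreeGen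

/-- The defining relations of `𝓐_{n,λ,ν}` on the free algebra. The first group of relations
presents `T_𝓑 𝓔 ⋊ k[S_n]` (here `T_𝓑 𝓔` is the path algebra of the quiver with vertex set `I^n`
and with one arrow `a_ℓ|_j : j → a_ℓ(j)` for all `ℓ`, `a`, `j` with `t(a) = j_ℓ`); `relI` and
`relII` are the relations imposed on it. -/
inductive Rel {n : ℕ} (lam : I → k) (nu : k) :
    FreeAlgebra k (Gen I n) → FreeAlgebra k (Gen I n) → Prop
  | vtx_mul_self (j : Fin n → I) : Rel lam nu (fV k j * fV k j) (fV k j)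
  | vtx_mul_ne (j j' : Fin n → I) (h : j ≠ j') : Rel lam nu (fV k j * fV k j') 0
  | sum_vtx : Rel lam nu (∑ j : Fin n → I, fV k j) 1
  | edge_vtx (l : Fin n) (a : DEdge I) (j : Fin n → I) (h : j l = tail a) :
      Rel lam nu (fE k l a * fV k j) (fV k (move l a j) * (fE k l a * fV k j))
  | edge_vtx_ne (l : Fin n) (a : DEdge I) (j : Fin n → I) (h : j l ≠ tail a) :
      Rel lam nu (fE k l a * fV k j) 0
  | perm_one : Rel lam nu (fS k 1) 1
  | perm_mul (σ τ : Equiv.Perm (Fin n)) : Rel lam nu (fS k (σ * τ)) (fS k σ * fS k τ)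
  | perm_vtx (σ : Equiv.Perm (Fin n)) (j : Fin n → I) :
      Rel lam nu (fS k σ * fV k j) (fV k (permute σ j) * fS k σ)
  | perm_edge (σ : Equiv.Perm (Fin n)) (l : Fin n) (a : DEdge I) :
      Rel lam nu (fS k σ * fE k l a) (fE k (σ l) a * fS k σ)
  | relI (l : Fin n) (j : Fin n → I) :
      Rel lam nu
        ((∑ a : Quiver.Total I,
            (fE k l (Sum.inl a) * fE k l (Sum.inr a) - fE k l (Sum.inr a) * fE k l (Sum.inl a))
          - algebraMap k _ (lam (j l))) * fV k j)
        (nu • ∑ m with m ≠ l ∧ j m = j l, fS k (Equiv.swap l m) * fV k j)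
  | relII (l m : Fin n) (a b : DEdge I) (j : Fin n → I) (hlm : l ≠ m)
      (ha : j l = tail a) (hb : j m = tail b) :
      Rel lam nu
        ((fE k l a * fV k (move m b j)) * (fE k m b * fV k j)
          - (fE k m b * fV k (move l a j)) * (fE k l a * fV k j))
        ((nu * pairing k a b) • (fS k (Equiv.swap l m) * fV k j))

/-- The algebra `𝓐_{n,λ,ν}`. -/
def Alg (n : ℕ) (lam : I → k) (nu : k) : Type max u v uk := RingQuot (Rel (n := n) lam nu)

instance (n : ℕ) (lam : I → k) (nu : k) : Ring (Alg n lam nu) :=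
  inferInstanceAs (Ring (RingQuot (Rel (n := n) lam nu)))

instance (n : ℕ) (lam : I → k) (nu : k) : Algebra k (Alg n lam nu) :=
  inferInstanceAs (Algebra k (RingQuot (Rel (n := n) lam nu)))

variable {n : ℕ} (lam : I → k) (nu : k)

/-- The quotient map from the free algebra onto `𝓐_{n,λ,ν}`. -/
def mkA : FreeAlgebra k (Gen I n) →ₐ[k] Alg n lam nu := RingQuot.mkAlgHom k (Rel lam nu)

lemma mkA_surjective : Function.Surjective (mkA (n := n) lam nu) :=
  RingQuot.mkAlgHom_surjective k (Rel lam nu)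

lemma mkA_rel {x y : FreeAlgebra k (Gen I n)} (h : Rel lam nu x y) :
    mkA lam nu x = mkA lam nu y := RingQuot.mkAlgHom_rel k h

/-- The idempotent `|_j` of `𝓐_{n,λ,ν}`. -/
def vtx (j : Fin n → I) : Alg n lam nu := mkA lam nu (fV k j)
/-- The element `a_ℓ` of `𝓐_{n,λ,ν}`. -/
def edge (l : Fin n) (a : DEdge I) : Alg n lam nu := mkA lam nu (fE k l a)
/-- The element of `𝓐_{n,λ,ν}` given by a permutation. -/
def perm (σ : Equiv.Perm (Fin n)) : Alg n lam nu := mkA lam nu (fS k σ)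

end Algebra

section Reflection

variable {k : Type uk} [CommRing k] {I : Type u} [Quiver.{v} I]
  [Fintype I] [Fintype (Quiver.Total I)] {n : ℕ} {lam : I → k} {nu : k}

/-- The set `R` of the edges of the double with head `i`. If `i` is a sink of `Q`, these are the
edges of `Q` with head `i`. For any other orientation, reorient `Q` at `i`: an edge `b : i → j` of
`Q` is replaced by `c := b^*`, and `c^*` is `-b`, which gives an isomorphism of the algebras of the
two quivers. Expressing everything through the original edges, `c^*` is `sgn c • rev c` for every
`c ∈ R`; this is the only source of signs in the operators below. -/
abbrev REdge (i : I) : Type max u v := {a : DEdge I // head a = i}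

/-- A configuration `x` encodes a triple `(j, D, ξ)` with `j ∈ I^n`, `D ⊆ Δ(j)`, `ξ : D → R`:
`x m = Sum.inl j_m` if `m ∉ D`, and `x m = Sum.inr (ξ m)` (so that `j_m = i`) if `m ∈ D`. -/
abbrev Conf (n : ℕ) (i : I) : Type max u v := Fin n → I ⊕ REdge i

/-- The tuple `j` of a configuration `(j, D, ξ)`. -/
def base {i : I} (x : Conf n i) : Fin n → I := fun m => Sum.elim id (fun _ => i) (x m)

/-- The tuple `t(j, ξ)` of a configuration `(j, D, ξ)`. -/
def src {i : I} (x : Conf n i) : Fin n → I := fun m => Sum.elim id (fun r => tail r.1) (x m)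

variable {V : Type w} [AddCommGroup V] [Module k V]

/-!
Families `f : Conf n i → V` with `f x ∈ V_{t(j, ξ)}` for each configuration `x = (j, D, ξ)` are
the elements of the direct sum of all `V(j, D)`. The operators below are defined on all of them at
once, by their components. An `𝓐_{n,λ,ν}`-module is given by its representation `ρ`.
-/

/-- The map `π_{j,p} : V(j, D) → V(j, D \ {p})`. -/
def piOp (ρ : Alg n lam nu →ₐ[k] Module.End k V) (i : I) (p : Fin n) :
    Module.End k (Conf n i → V) :=
  LinearMap.pi fun x => if x p = Sum.inl i then
    ∑ r : REdge i, ρ (edge lam nu p r.1) ∘ₗ LinearMap.proj (Function.update x p (Sum.inr r)) else 0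

/-- The map `μ_{j,p} : V(j, D \ {p}) → V(j, D)`. The sign accounts for the edges of `Q` with
tail `i`; it is `1` if `i` is a sink. -/
def muOp (ρ : Alg n lam nu →ₐ[k] Module.End k V) (i : I) (p : Fin n) :
    Module.End k (Conf n i → V) :=
  LinearMap.pi fun x => match x p with
    | Sum.inl _ => 0
    | Sum.inr r => sgn k r.1 •
        (ρ (edge lam nu p (rev r.1)) ∘ₗ LinearMap.proj (Function.update x p (Sum.inl i)))

/-- The map `σ|_j : V(j, D) → V(σ(j), σ(D))`. -/
def permOp (ρ : Alg n lam nu →ₐ[k] Module.End k V) (i : I) (σ : Equiv.Perm (Fin n)) :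
    Module.End k (Conf n i → V) :=
  LinearMap.pi fun x => ρ (perm lam nu σ) ∘ₗ LinearMap.proj (permute σ⁻¹ x)

/-- The projection onto the components with given `j`. -/
def vtxOp (k : Type uk) [CommRing k] (V : Type w) [AddCommGroup V] [Module k V] (i : I)
    (j : Fin n → I) : Module.End k (Conf n i → V) :=
  LinearMap.pi fun x => if base x = j then LinearMap.proj x else 0

/-- The map `a_ℓ|_{j,D} : V(j, D) → V(a_ℓ(j), D)`, for `h(a), t(a) ≠ i`. -/
def slideOp (ρ : Alg n lam nu →ₐ[k] Module.End k V) (i : I) (a : DEdge I) (l : Fin n) :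
    Module.End k (Conf n i → V) :=
  LinearMap.pi fun x => if x l = Sum.inl (head a) then
    ρ (edge lam nu l a) ∘ₗ LinearMap.proj (Function.update x l (Sum.inl (tail a))) else 0

/-- The projection `τ^!_{r,ℓ,j,D} : V(j, D) → V(r^*_ℓ(j), D \ {ℓ})`. -/
def tauUp (k : Type uk) [CommRing k] (V : Type w) [AddCommGroup V] [Module k V] {i : I}
    (r : REdge i) (l : Fin n) : Module.End k (Conf n i → V) :=
  LinearMap.pi fun x => if x l = Sum.inl (tail r.1) then
    LinearMap.proj (Function.update x l (Sum.inr r)) else 0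

/-- The inclusion `τ_{r,ℓ,j,D,!} : V(r^*_ℓ(j), D \ {ℓ}) → V(j, D)`. -/
def tauDown (k : Type uk) [CommRing k] (V : Type w) [AddCommGroup V] [Module k V] {i : I}
    (r : REdge i) (l : Fin n) : Module.End k (Conf n i → V) :=
  LinearMap.pi fun x => if x l = Sum.inr r then
    LinearMap.proj (Function.update x l (Sum.inl (tail r.1))) else 0

/-- On `V(j, D)` with `ℓ ∈ D`, the sum of the operators `s_{m ℓ}|_j` over all `m ∈ D \ {ℓ}`. -/
def swapSum (ρ : Alg n lam nu →ₐ[k] Module.End k V) (i : I) (l : Fin n) :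
    Module.End k (Conf n i → V) :=
  LinearMap.pi fun x => ∑ m with m ≠ l ∧ (x m).isRight ∧ (x l).isRight,
    LinearMap.proj x ∘ₗ permOp ρ i (Equiv.swap m l)

/-- The map `θ_{a,ℓ,j,D} = (-λ_i + μ_ℓ π_ℓ + ν ∑_{m ∈ D} s_{m ℓ}) τ_{a,ℓ,!}` from `V(j, D)` to
`V(a_ℓ(j), D ∪ {ℓ})`, for an edge `a` with head `i`. -/
def thetaOp (ρ : Alg n lam nu →ₐ[k] Module.End k V) {i : I} (a : REdge i) (l : Fin n) :
    Module.End k (Conf n i → V) :=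
  (-(lam i • LinearMap.id) + muOp ρ i l ∘ₗ piOp ρ i l + nu • swapSum ρ i l) ∘ₗ tauDown k V a l

/-- The operator `a'_ℓ` that gives the action of the edge `a` in the `ℓ`-th position on `F_i(V)`:
it is `τ^!_{a^*,ℓ}` if `t(a) = i`, `θ_{a,ℓ}` if `h(a) = i`, and `a_ℓ` on components otherwise. The
sign in the first case is `1` if `i` is a sink. -/
def edgeOp (ρ : Alg n lam nu →ₐ[k] Module.End k V) (i : I) (l : Fin n) (a : DEdge I) :
    Module.End k (Conf n i → V) :=
  if h : tail a = i then sgn k (rev a) • tauUp k V ⟨rev a, (head_rev a).trans h⟩ l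
  else if h : head a = i then thetaOp ρ ⟨a, h⟩ l
  else slideOp ρ i a l

/-- The module `F_i(V) = ⨁_j V'_j`, where `V'_j ⊆ V(j, Δ(j))` is the intersection of the kernels
of `π_{j,p}`, `p ∈ Δ(j)`. The second condition says that only components with `D = Δ(j)`
are present. -/
def reflection (ρ : Alg n lam nu →ₐ[k] Module.End k V) (i : I) : Submodule k (Conf n i → V) where
  carrier := {f | (∀ x, ρ (vtx lam nu (src x)) (f x) = f x) ∧
    (∀ x, (∃ m, x m = Sum.inl i) → f x = 0) ∧ ∀ p, piOp ρ i p f = 0}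
  add_mem' := by
    rintro f g ⟨h1, h2, h3⟩ ⟨h1', h2', h3'⟩
    refine ⟨fun x => ?_, fun x hx => ?_, fun p => ?_⟩
    · simp [h1 x, h1' x]
    · simp [h2 x hx, h2' x hx]
    · simp [h3 p, h3' p]
  zero_mem' := by simp
  smul_mem' := by
    rintro c f ⟨h1, h2, h3⟩
    refine ⟨fun x => ?_, fun x hx => ?_, fun p => ?_⟩
    · simp [h1 x]
    · simp [h2 x hx]
    · simp [h3 p]

/-! ### The representation property -/

section Basic

lemma rev_rev (a : DEdge I) : rev (rev a) = a := by cases a <;> rfl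

lemma sgn_mul_self (a : DEdge I) : sgn k a * sgn k a = 1 := by cases a <;> simp [sgn]

lemma sgn_rev (a : DEdge I) : sgn k (rev a) = - sgn k a := by cases a <;> simp [sgn, rev]

lemma pairing_rev_right (a b : DEdge I) :
    pairing k a (rev b) = if a = b then - sgn k b else 0 := by
  rcases a with a | a <;> rcases b with b | b <;> simp [pairing, rev, sgn, eq_comm]

lemma pairing_rev_left (a b : DEdge I) :
    pairing k (rev a) b = if a = b then sgn k a else 0 := by
  rcases a with a | a <;> rcases b with b | b <;> simp [pairing, rev, sgn, eq_comm]

lemma pairing_swap (a b : DEdge I) : pairing k b a = - pairing k a b := by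
  rcases a with a | a <;> rcases b with b | b <;> 
    (simp [pairing, rev, eq_comm]; try (split_ifs <;> simp))

lemma pairing_eq_zero (a b : DEdge I) (h : a ≠ rev b) : pairing k a b = 0 := by
  rcases a with a | a <;> rcases b with b | b <;> simp_all [pairing, rev, eq_comm]

variable (lam nu)

lemma sum_vtx : ∑ j : Fin n → I, vtx lam nu j = 1 := by
  have := mkA_rel lam nu (Rel.sum_vtx (n := n))
  simpa [vtx] using this

lemma ext_vtx {a b : Alg n lam nu} (h : ∀ j, a * vtx lam nu j = b * vtx lam nu j) : a = b := by
  rw [← mul_one a, ← mul_one b, ← sum_vtx, Finset.mul_sum, Finset.mul_sum]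
  exact Finset.sum_congr rfl fun j _ => h j

lemma vtx_mul_self (j : Fin n → I) : vtx lam nu j * vtx lam nu j = vtx lam nu j := by
  have := mkA_rel lam nu (Rel.vtx_mul_self j)
  simpa [vtx] using this

lemma edge_vtx (l : Fin n) (a : DEdge I) (j : Fin n → I) (h : j l = tail a) :
    edge lam nu l a * vtx lam nu j = vtx lam nu (move l a j) * (edge lam nu l a * vtx lam nu j) := by
  have := mkA_rel lam nu (Rel.edge_vtx l a j h)
  simpa [vtx, edge] using this

lemma edge_vtx_ne (l : Fin n) (a : DEdge I) (j : Fin n → I) (h : j l ≠ tail a) :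
    edge lam nu l a * vtx lam nu j = 0 := by
  have := mkA_rel lam nu (Rel.edge_vtx_ne l a j h)
  simpa [vtx, edge] using this

lemma perm_one : perm lam nu (1 : Equiv.Perm (Fin n)) = 1 := by
  have := mkA_rel lam nu (Rel.perm_one (n := n))
  simpa [perm] using this

lemma perm_mul (σ τ : Equiv.Perm (Fin n)) :
    perm lam nu (σ * τ) = perm lam nu σ * perm lam nu τ := by
  have := mkA_rel lam nu (Rel.perm_mul σ τ)
  simpa [perm] using this

lemma perm_vtx (σ : Equiv.Perm (Fin n)) (j : Fin n → I) :
    perm lam nu σ * vtx lam nu j = vtx lam nu (permute σ j) * perm lam nu σ := by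
  have := mkA_rel lam nu (Rel.perm_vtx σ j)
  simpa [perm, vtx] using this

lemma perm_edge (σ : Equiv.Perm (Fin n)) (l : Fin n) (a : DEdge I) :
    perm lam nu σ * edge lam nu l a = edge lam nu (σ l) a * perm lam nu σ := by
  have := mkA_rel lam nu (Rel.perm_edge σ l a)
  simpa [perm, edge] using this

lemma relI (l : Fin n) (j : Fin n → I) :
    (∑ b : DEdge I, sgn k b • (edge lam nu l b * edge lam nu l (rev b))) * vtx lam nu j
      = lam (j l) • vtx lam nu j
        + nu • ∑ m with m ≠ l ∧ j m = j l, perm lam nu (Equiv.swap l m) * vtx lam nu j := by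
  have := mkA_rel lam nu (Rel.relI l j)
  simp only [map_mul, map_sub, map_sum, map_smul, AlgHom.commutes] at this
  simp only [Fintype.sum_sum_type, sgn, rev, one_smul, neg_smul, Finset.sum_neg_distrib,
    ← sub_eq_add_neg, ← Finset.sum_sub_distrib]
  rw [sub_mul, sub_eq_iff_eq_add, ← Algebra.smul_def] at this
  rw [add_comm]
  exact this

lemma edge_edge (l m : Fin n) (a b : DEdge I) (j : Fin n → I) (hlm : l ≠ m) :
    edge lam nu l a * edge lam nu m b * vtx lam nu j
      = edge lam nu m b * edge lam nu l a * vtx lam nu j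
        + if j l = tail a ∧ j m = tail b then
            (nu * pairing k a b) • (perm lam nu (Equiv.swap l m) * vtx lam nu j) else 0 := by
  by_cases hb : j m = tail b
  · by_cases ha : j l = tail a
    · have := mkA_rel lam nu (Rel.relII l m a b j hlm ha hb)
      simp only [map_mul, map_sub, map_smul] at this
      change (edge lam nu l a * vtx lam nu (move m b j)) * (edge lam nu m b * vtx lam nu j)
          - (edge lam nu m b * vtx lam nu (move l a j)) * (edge lam nu l a * vtx lam nu j)
        = (nu * pairing k a b) • (perm lam nu (Equiv.swap l m) * vtx lam nu j) at this
      rw [mul_assoc, ← edge_vtx lam nu m b j hb, mul_assoc, ← edge_vtx lam nu l a j ha,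
        sub_eq_iff_eq_add'] at this
      simp only [ha, hb, and_self, if_true, mul_assoc]
      exact this
    · rw [if_neg (by tauto), mul_assoc, edge_vtx lam nu m b j hb, ← mul_assoc,
        edge_vtx_ne lam nu l a (move m b j) (by simpa [move, Function.update_of_ne hlm] using ha),
        mul_assoc, edge_vtx_ne lam nu l a j ha]
      simp
  · rw [if_neg (by tauto), mul_assoc, edge_vtx_ne lam nu m b j hb, mul_assoc]
    by_cases ha : j l = tail a
    · rw [edge_vtx lam nu l a j ha, ← mul_assoc (edge lam nu m b),
        edge_vtx_ne lam nu m b (move l a j)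
          (by simpa [move, Function.update_of_ne hlm.symm] using hb)]
      simp
    · rw [edge_vtx_ne lam nu l a j ha]; simp

lemma edge_comm (l m : Fin n) (a b : DEdge I) (hlm : l ≠ m) (h : pairing k a b = 0) :
    edge lam nu l a * edge lam nu m b = edge lam nu m b * edge lam nu l a :=
  ext_vtx lam nu fun j => by rw [edge_edge lam nu l m a b j hlm, h]; simp

variable {lam nu}
variable (ρ : Alg n lam nu →ₐ[k] Module.End k V)

lemma rho_edge_comm {l m : Fin n} {a b : DEdge I} (hlm : l ≠ m) (h : pairing k a b = 0) (u : V) :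
    ρ (edge lam nu l a) (ρ (edge lam nu m b) u) = ρ (edge lam nu m b) (ρ (edge lam nu l a) u) := by
  simp only [← Module.End.mul_apply, ← map_mul, edge_comm lam nu l m a b hlm h]

lemma rho_edge_edge {l m : Fin n} {a b : DEdge I} {j : Fin n → I} (hlm : l ≠ m) {u : V}
    (hu : ρ (vtx lam nu j) u = u) (ha : j l = tail a) (hb : j m = tail b) :
    ρ (edge lam nu l a) (ρ (edge lam nu m b) u) = ρ (edge lam nu m b) (ρ (edge lam nu l a) u)
      + (nu * pairing k a b) • ρ (perm lam nu (Equiv.swap l m)) u := by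
  have h := congrArg (fun y => ρ y u) (edge_edge lam nu l m a b j hlm)
  simpa [ha, hb, map_mul, hu] using h

lemma rho_edge_zero {l : Fin n} {a : DEdge I} {j : Fin n → I} {u : V}
    (hu : ρ (vtx lam nu j) u = u) (ha : j l ≠ tail a) : ρ (edge lam nu l a) u = 0 := by
  have h := congrArg (fun y => ρ y u) (edge_vtx_ne lam nu l a j ha)
  simpa [map_mul, hu] using h

lemma rho_perm_edge (σ : Equiv.Perm (Fin n)) (l : Fin n) (a : DEdge I) (u : V) :
    ρ (perm lam nu σ) (ρ (edge lam nu l a) u) = ρ (edge lam nu (σ l) a) (ρ (perm lam nu σ) u) := by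
  simp only [← Module.End.mul_apply, ← map_mul, perm_edge]

lemma rho_perm_mul (σ τ : Equiv.Perm (Fin n)) (u : V) :
    ρ (perm lam nu (σ * τ)) u = ρ (perm lam nu σ) (ρ (perm lam nu τ) u) := by
  simp only [← Module.End.mul_apply, ← map_mul, perm_mul]

lemma rho_vtx_edge {l : Fin n} {a : DEdge I} {j j' : Fin n → I} {u : V}
    (hu : ρ (vtx lam nu j) u = u) (ha : j l = tail a) (hj : j' = Function.update j l (head a)) :
    ρ (vtx lam nu j') (ρ (edge lam nu l a) u) = ρ (edge lam nu l a) u := by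
  have h := congrArg (fun y => ρ y u) (edge_vtx lam nu l a j ha)
  simp only [map_mul, Module.End.mul_apply, hu] at h
  rw [hj]; exact h.symm

lemma rho_vtx_perm {σ : Equiv.Perm (Fin n)} {j j' : Fin n → I} {u : V}
    (hu : ρ (vtx lam nu j) u = u) (hj : j' = permute σ j) :
    ρ (vtx lam nu j') (ρ (perm lam nu σ) u) = ρ (perm lam nu σ) u := by
  have h := congrArg (fun y => ρ y u) (perm_vtx lam nu σ j)
  simp only [map_mul, Module.End.mul_apply, hu] at h
  rw [hj]; exact h.symm

lemma rho_relI (l : Fin n) (j : Fin n → I) {u : V} (hu : ρ (vtx lam nu j) u = u) :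
    ∑ b : DEdge I, sgn k b • ρ (edge lam nu l b) (ρ (edge lam nu l (rev b)) u)
      = lam (j l) • u
        + nu • ∑ m with m ≠ l ∧ j m = j l, ρ (perm lam nu (Equiv.swap l m)) u := by
  have h := congrArg (fun y => ρ y u) (relI lam nu l j)
  simpa [map_mul, hu, LinearMap.sum_apply] using h

end Basic

section Conf

variable {i : I}

lemma src_update (x : Conf n i) (p : Fin n) (s : I ⊕ REdge i) :
    src (Function.update x p s) = Function.update (src x) p (Sum.elim id (fun r => tail r.1) s) := by
  ext m; by_cases h : m = p
  · subst h; simp [src]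
  · simp [src, h]

lemma base_update (x : Conf n i) (p : Fin n) (s : I ⊕ REdge i) :
    base (Function.update x p s) = Function.update (base x) p (Sum.elim id (fun _ => i) s) := by
  ext m; by_cases h : m = p
  · subst h; simp [base]
  · simp [base, h]

lemma permute_inv_apply {S : Type*} (σ : Equiv.Perm (Fin n)) (x : Fin n → S) (m : Fin n) :
    permute σ⁻¹ x m = x (σ m) := rfl

lemma permute_update {S : Type*} (σ : Equiv.Perm (Fin n)) (x : Fin n → S) (l : Fin n) (s : S) :
    permute σ⁻¹ (Function.update x (σ l) s) = Function.update (permute σ⁻¹ x) l s := by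
  ext m; by_cases h : m = l
  · subst h; simp [permute_inv_apply]
  · simp [permute_inv_apply, h]

lemma permute_update_of_fix {S : Type*} (σ : Equiv.Perm (Fin n)) (x : Fin n → S) (l : Fin n)
    (s : S) (h : σ l = l) :
    permute σ⁻¹ (Function.update x l s) = Function.update (permute σ⁻¹ x) l s := by
  conv_lhs => rw [← h]
  exact permute_update σ x l s

lemma src_permute (σ : Equiv.Perm (Fin n)) (x : Conf n i) : src (permute σ x) = permute σ (src x) :=
  rfl

lemma base_permute (σ : Equiv.Perm (Fin n)) (x : Conf n i) :
    base (permute σ x) = permute σ (base x) := rfl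

lemma permute_permute_inv {S : Type*} (σ : Equiv.Perm (Fin n)) (x : Fin n → S) :
    permute σ (permute σ⁻¹ x) = x := by
  ext m; simp [permute, Equiv.Perm.inv_def]

end Conf

section Apply

variable (ρ : Alg n lam nu →ₐ[k] Module.End k V) {i : I}

lemma piOp_apply (p : Fin n) (f : Conf n i → V) (x : Conf n i) :
    piOp ρ i p f x = if x p = Sum.inl i then
      ∑ r : REdge i, ρ (edge lam nu p r.1) (f (Function.update x p (Sum.inr r))) else 0 := by
  simp only [piOp, LinearMap.pi_apply]
  split_ifs <;> simp [LinearMap.sum_apply]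

lemma muOp_apply_inl (p : Fin n) (f : Conf n i → V) (x : Conf n i) {s : I} (h : x p = Sum.inl s) :
    muOp ρ i p f x = 0 := by
  simp only [muOp, LinearMap.pi_apply, h]
  rfl

lemma muOp_apply_inr (p : Fin n) (f : Conf n i → V) (x : Conf n i) {r : REdge i}
    (h : x p = Sum.inr r) :
    muOp ρ i p f x = sgn k r.1 • ρ (edge lam nu p (rev r.1))
      (f (Function.update x p (Sum.inl i))) := by
  simp only [muOp, LinearMap.pi_apply, h]
  rfl

lemma permOp_apply (σ : Equiv.Perm (Fin n)) (f : Conf n i → V) (x : Conf n i) :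
    permOp ρ i σ f x = ρ (perm lam nu σ) (f (permute σ⁻¹ x)) := rfl

lemma vtxOp_apply (j : Fin n → I) (f : Conf n i → V) (x : Conf n i) :
    vtxOp k V i j f x = if base x = j then f x else 0 := by
  simp only [vtxOp, LinearMap.pi_apply]
  split_ifs <;> simp

lemma slideOp_apply (a : DEdge I) (l : Fin n) (f : Conf n i → V) (x : Conf n i) :
    slideOp ρ i a l f x = if x l = Sum.inl (head a) then
      ρ (edge lam nu l a) (f (Function.update x l (Sum.inl (tail a)))) else 0 := by
  simp only [slideOp, LinearMap.pi_apply]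
  split_ifs <;> simp

lemma tauUp_apply (r : REdge i) (l : Fin n) (f : Conf n i → V) (x : Conf n i) :
    tauUp k V r l f x = if x l = Sum.inl (tail r.1) then
      f (Function.update x l (Sum.inr r)) else 0 := by
  simp only [tauUp, LinearMap.pi_apply]
  split_ifs <;> simp

lemma tauDown_apply (r : REdge i) (l : Fin n) (f : Conf n i → V) (x : Conf n i) :
    tauDown k V r l f x = if x l = Sum.inr r then
      f (Function.update x l (Sum.inl (tail r.1))) else 0 := by
  simp only [tauDown, LinearMap.pi_apply]
  split_ifs <;> simp

lemma swapSum_apply (l : Fin n) (f : Conf n i → V) (x : Conf n i) :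
    swapSum ρ i l f x = ∑ m with m ≠ l ∧ (x m).isRight ∧ (x l).isRight,
      permOp ρ i (Equiv.swap m l) f x := by
  simp [swapSum, LinearMap.sum_apply]

lemma thetaOp_apply (a : REdge i) (l : Fin n) (f : Conf n i → V) :
    thetaOp ρ a l f = -(lam i • tauDown k V a l f) + muOp ρ i l (piOp ρ i l (tauDown k V a l f))
      + nu • swapSum ρ i l (tauDown k V a l f) := by
  simp [thetaOp]

end Apply

section Ops

variable (ρ : Alg n lam nu →ₐ[k] Module.End k V) {i : I}

/-- Each component of the family lies in the summand of `V` that its index asks for. -/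
def Graded (f : Conf n i → V) : Prop := ∀ x, ρ (vtx lam nu (src x)) (f x) = f x

lemma permOp_mul (σ τ : Equiv.Perm (Fin n)) (f : Conf n i → V) :
    permOp ρ i (σ * τ) f = permOp ρ i σ (permOp ρ i τ f) := by
  ext x
  simp only [permOp_apply, rho_perm_mul]
  rfl

lemma permOp_piOp (σ : Equiv.Perm (Fin n)) (l : Fin n) (f : Conf n i → V) :
    permOp ρ i σ (piOp ρ i l f) = piOp ρ i (σ l) (permOp ρ i σ f) := by
  ext x
  rw [permOp_apply, piOp_apply, piOp_apply]
  by_cases h : x (σ l) = Sum.inl i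
  · rw [if_pos (show permute σ⁻¹ x l = Sum.inl i from h), if_pos h, map_sum]
    simp only [permOp_apply, permute_update, rho_perm_edge]
  · rw [if_neg (show ¬ permute σ⁻¹ x l = Sum.inl i from h), if_neg h, map_zero]

lemma permOp_muOp (σ : Equiv.Perm (Fin n)) (l : Fin n) (f : Conf n i → V) :
    permOp ρ i σ (muOp ρ i l f) = muOp ρ i (σ l) (permOp ρ i σ f) := by
  ext x
  rcases hx : x (σ l) with s | r
  · rw [muOp_apply_inl ρ (σ l) _ x hx, permOp_apply, muOp_apply_inl ρ l _ _ (s := s) hx, map_zero]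
  · rw [muOp_apply_inr ρ (σ l) _ x hx, permOp_apply, muOp_apply_inr ρ l _ _ (r := r) hx, map_smul,
      permOp_apply, permute_update, rho_perm_edge]

lemma permute_swap (x : Conf n i) {l m : Fin n} (hlm : l ≠ m) :
    permute (Equiv.swap l m)⁻¹ x = Function.update (Function.update x l (x m)) m (x l) := by
  ext q
  rw [permute_inv_apply]
  by_cases h1 : q = m
  · subst h1; simp
  · by_cases h2 : q = l
    · subst h2; simp [h1]
    · simp [h1, h2, Equiv.swap_apply_of_ne_of_ne]

lemma piOp_comm (hi : ∀ a : DEdge I, head a = i → tail a ≠ i) {p q : Fin n} (hpq : p ≠ q)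
    (f : Conf n i → V) : piOp ρ i p (piOp ρ i q f) = piOp ρ i q (piOp ρ i p f) := by
  ext x
  simp only [piOp_apply, Function.update_of_ne hpq, Function.update_of_ne hpq.symm]
  by_cases hp : x p = Sum.inl i <;> by_cases hq : x q = Sum.inl i <;>
    simp only [hp, hq, if_true, if_false, map_zero, Finset.sum_const_zero, map_sum]
  rw [Finset.sum_comm]
  refine Finset.sum_congr rfl fun r _ => Finset.sum_congr rfl fun r' _ => ?_
  rw [Function.update_comm hpq, rho_edge_comm ρ hpq]
  refine pairing_eq_zero _ _ fun h => hi r.1 r.2 ?_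
  have := congrArg tail h
  rw [tail_rev] at this
  have h2 := congrArg head h
  rw [head_rev, r'.2] at h2
  exact absurd h2.symm (hi _ r.2)

lemma muOp_comm (hi : ∀ a : DEdge I, head a = i → tail a ≠ i) {p q : Fin n} (hpq : p ≠ q)
    (f : Conf n i → V) : muOp ρ i p (muOp ρ i q f) = muOp ρ i q (muOp ρ i p f) := by
  ext x
  rcases hp : x p with s | r <;> rcases hq : x q with s' | r'
  · rw [muOp_apply_inl ρ p _ x hp, muOp_apply_inl ρ q _ x hq]
  · rw [muOp_apply_inl ρ p _ x hp, muOp_apply_inr ρ q _ x hq,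
      muOp_apply_inl ρ p _ _ (s := s) (by rw [Function.update_of_ne hpq, hp])]
    simp
  · rw [muOp_apply_inl ρ q _ x hq, muOp_apply_inr ρ p _ x hp,
      muOp_apply_inl ρ q _ _ (s := s') (by rw [Function.update_of_ne hpq.symm, hq])]
    simp
  · rw [muOp_apply_inr ρ q _ x hq, muOp_apply_inr ρ p _ x hp,
      muOp_apply_inr ρ q _ _ (r := r') (by rw [Function.update_of_ne hpq.symm, hq]),
      muOp_apply_inr ρ p _ _ (r := r) (by rw [Function.update_of_ne hpq, hp]),
      Function.update_comm hpq, map_smul, map_smul, rho_edge_comm ρ hpq, smul_comm]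
    refine pairing_eq_zero _ _ fun h => hi r'.1 r'.2 ?_
    have h1 := congrArg tail h
    rw [tail_rev, r.2, tail_rev, head_rev] at h1
    exact h1.symm

lemma piOp_muOp {l m : Fin n} (hlm : l ≠ m) {f : Conf n i → V} (hf : Graded ρ f) (x : Conf n i) :
    piOp ρ i l (muOp ρ i m f) x = muOp ρ i m (piOp ρ i l f) x
      - nu • (if x l = Sum.inl i ∧ (x m).isRight then permOp ρ i (Equiv.swap l m) f x else 0) := by
  rcases hm : x m with s | r
  · rw [muOp_apply_inl ρ m _ x hm, if_neg (by simp), piOp_apply]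
    have key : ∀ y : I ⊕ REdge i, muOp ρ i m f (Function.update x l y) = 0 := fun y =>
      muOp_apply_inl ρ m f _ (s := s) (by rw [Function.update_of_ne hlm.symm, hm])
    simp [key]
  · rw [muOp_apply_inr ρ m _ x hm, piOp_apply, piOp_apply, Function.update_of_ne hlm]
    by_cases hl : x l = Sum.inl i
    · rw [if_pos hl, if_pos hl, if_pos (by simp [hl])]
      have key : ∀ r' : REdge i, ρ (edge lam nu l r'.1)
          (muOp ρ i m f (Function.update x l (Sum.inr r')))
          = sgn k r.1 • ρ (edge lam nu m (rev r.1)) (ρ (edge lam nu l r'.1)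
            (f (Function.update (Function.update x m (Sum.inl i)) l (Sum.inr r'))))
          - if r' = r then nu • permOp ρ i (Equiv.swap l m) f x else 0 := by
        intro r'
        rw [muOp_apply_inr ρ m _ _ (r := r) (by rw [Function.update_of_ne hlm.symm, hm]), map_smul,
          Function.update_comm hlm.symm]
        rw [rho_edge_edge ρ hlm (hf _), smul_add, sub_eq_add_neg]
        · congr 1
          rw [pairing_rev_right]
          by_cases hr : r' = r
          · subst hr
            rw [if_pos rfl, if_pos rfl, smul_smul, permOp_apply, permute_swap x hlm, hl, hm,
              mul_neg, mul_neg, mul_left_comm, sgn_mul_self, mul_one, neg_smul,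
              Function.update_comm hlm]
          · rw [if_neg (fun h => hr (Subtype.ext h)), if_neg hr]
            simp
        · simp [src_update, hlm]
        · simp [src_update, tail_rev, r.2, hlm.symm]
      rw [Finset.sum_congr rfl fun r' _ => key r', Finset.sum_sub_distrib]
      simp [map_sum, Finset.smul_sum]
    · simp [hl]

lemma sum_REdge {M : Type*} [AddCommMonoid M] (F : DEdge I → M)
    (h : ∀ b, head b ≠ i → F b = 0) : ∑ r : REdge i, F r.1 = ∑ b, F b := by
  rw [← Finset.sum_subtype (Finset.univ.filter fun b : DEdge I => head b = i) (by simp) F,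
    Finset.sum_filter]
  refine Finset.sum_congr rfl fun b _ => ?_
  split_ifs with hb
  · rfl
  · exact (h b hb).symm

lemma piOp_muOp_self {l : Fin n} {f : Conf n i → V} (hf : Graded ρ f) (x : Conf n i)
    (hl : x l = Sum.inl i) (hx : ∀ m, m ≠ l → src x m ≠ i) :
    piOp ρ i l (muOp ρ i l f) x = lam i • f x := by
  have hs : src x l = i := by simp [src, hl]
  have h := rho_relI ρ l (src x) (hf x)
  rw [Finset.filter_false_of_mem (by
    intro m _ hm; exact hx m hm.1 (hm.2.trans hs)), Finset.sum_empty, smul_zero, add_zero, hs] at h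
  rw [piOp_apply, if_pos hl, ← h, ← sum_REdge (i := i)]
  · refine Finset.sum_congr rfl fun r _ => ?_
    rw [muOp_apply_inr ρ l _ _ (r := r) (by simp), Function.update_idem, ← hl,
      Function.update_eq_self, map_smul]
  · intro b hb
    rw [rho_edge_zero ρ (hf x) (by rw [hs, tail_rev]; exact fun h => hb h.symm)]
    simp

/-! Commutation of `τ` and the slides with the other operators. -/

lemma tauDown_piOp (r : REdge i) {l m : Fin n} (hlm : l ≠ m) (f : Conf n i → V) :
    tauDown k V r l (piOp ρ i m f) = piOp ρ i m (tauDown k V r l f) := by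
  ext x
  simp only [tauDown_apply, piOp_apply, Function.update_of_ne hlm, Function.update_of_ne hlm.symm,
    Function.update_comm hlm]
  split_ifs <;> simp

lemma tauUp_piOp (r : REdge i) {l m : Fin n} (hlm : l ≠ m) (f : Conf n i → V) :
    tauUp k V r l (piOp ρ i m f) = piOp ρ i m (tauUp k V r l f) := by
  ext x
  simp only [tauUp_apply, piOp_apply, Function.update_of_ne hlm, Function.update_of_ne hlm.symm,
    Function.update_comm hlm]
  split_ifs <;> simp

lemma tauDown_muOp (r : REdge i) {l m : Fin n} (hlm : l ≠ m) (f : Conf n i → V) :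
    tauDown k V r l (muOp ρ i m f) = muOp ρ i m (tauDown k V r l f) := by
  ext x
  rcases hm : x m with s | r'
  · rw [muOp_apply_inl ρ m _ x hm, tauDown_apply, muOp_apply_inl ρ m _ _ (s := s)
      (by rw [Function.update_of_ne hlm.symm, hm])]
    simp
  · rw [muOp_apply_inr ρ m _ x hm, tauDown_apply, muOp_apply_inr ρ m _ _ (r := r')
      (by rw [Function.update_of_ne hlm.symm, hm]), tauDown_apply, Function.update_of_ne hlm,
      Function.update_comm hlm]
    split_ifs <;> simp

lemma tauUp_muOp (r : REdge i) {l m : Fin n} (hlm : l ≠ m) (f : Conf n i → V) :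
    tauUp k V r l (muOp ρ i m f) = muOp ρ i m (tauUp k V r l f) := by
  ext x
  rcases hm : x m with s | r'
  · rw [muOp_apply_inl ρ m _ x hm, tauUp_apply, muOp_apply_inl ρ m _ _ (s := s)
      (by rw [Function.update_of_ne hlm.symm, hm])]
    simp
  · rw [muOp_apply_inr ρ m _ x hm, tauUp_apply, muOp_apply_inr ρ m _ _ (r := r')
      (by rw [Function.update_of_ne hlm.symm, hm]), tauUp_apply, Function.update_of_ne hlm,
      Function.update_comm hlm]
    split_ifs <;> simp

lemma tauDown_tauDown (r r' : REdge i) {l m : Fin n} (hlm : l ≠ m) (f : Conf n i → V) :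
    tauDown k V r l (tauDown k V r' m f) = tauDown k V r' m (tauDown k V r l f) := by
  ext x
  simp only [tauDown_apply, Function.update_of_ne hlm, Function.update_of_ne hlm.symm,
    Function.update_comm hlm]
  split_ifs <;> simp

lemma tauUp_tauUp (r r' : REdge i) {l m : Fin n} (hlm : l ≠ m) (f : Conf n i → V) :
    tauUp k V r l (tauUp k V r' m f) = tauUp k V r' m (tauUp k V r l f) := by
  ext x
  simp only [tauUp_apply, Function.update_of_ne hlm, Function.update_of_ne hlm.symm,
    Function.update_comm hlm]
  split_ifs <;> simp

lemma tauUp_tauDown (r r' : REdge i) {l m : Fin n} (hlm : l ≠ m) (f : Conf n i → V) :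
    tauUp k V r l (tauDown k V r' m f) = tauDown k V r' m (tauUp k V r l f) := by
  ext x
  simp only [tauUp_apply, tauDown_apply, Function.update_of_ne hlm, Function.update_of_ne hlm.symm,
    Function.update_comm hlm]
  split_ifs <;> simp

lemma slideOp_tauUp (a : DEdge I) (r : REdge i) {l m : Fin n} (hlm : l ≠ m) (f : Conf n i → V) :
    slideOp ρ i a l (tauUp k V r m f) = tauUp k V r m (slideOp ρ i a l f) := by
  ext x
  simp only [tauUp_apply, slideOp_apply, Function.update_of_ne hlm, Function.update_of_ne hlm.symm,
    Function.update_comm hlm]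
  split_ifs <;> simp

lemma slideOp_tauDown (a : DEdge I) (r : REdge i) {l m : Fin n} (hlm : l ≠ m) (f : Conf n i → V) :
    slideOp ρ i a l (tauDown k V r m f) = tauDown k V r m (slideOp ρ i a l f) := by
  ext x
  simp only [tauDown_apply, slideOp_apply, Function.update_of_ne hlm,
    Function.update_of_ne hlm.symm, Function.update_comm hlm]
  split_ifs <;> simp

lemma slideOp_piOp (a : DEdge I) (ha : tail a ≠ i) {l m : Fin n} (hlm : l ≠ m)
    (f : Conf n i → V) :
    slideOp ρ i a l (piOp ρ i m f) = piOp ρ i m (slideOp ρ i a l f) := by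
  ext x
  simp only [piOp_apply, slideOp_apply, Function.update_of_ne hlm,
    Function.update_of_ne hlm.symm, Function.update_comm hlm]
  by_cases h1 : x l = Sum.inl (head a) <;> by_cases h2 : x m = Sum.inl i <;>
    simp only [h1, h2, if_true, if_false, map_zero, Finset.sum_const_zero, map_sum]
  refine Finset.sum_congr rfl fun r _ => ?_
  rw [rho_edge_comm ρ hlm]
  refine pairing_eq_zero _ _ fun h => ha ?_
  rw [h, tail_rev, r.2]

lemma slideOp_muOp (a : DEdge I) (ha : head a ≠ i) {l m : Fin n} (hlm : l ≠ m)
    (f : Conf n i → V) :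
    slideOp ρ i a l (muOp ρ i m f) = muOp ρ i m (slideOp ρ i a l f) := by
  ext x
  rcases hm : x m with s | r
  · rw [muOp_apply_inl ρ m _ x hm, slideOp_apply, muOp_apply_inl ρ m _ _ (s := s)
      (by rw [Function.update_of_ne hlm.symm, hm])]
    simp
  · rw [muOp_apply_inr ρ m _ x hm, slideOp_apply, muOp_apply_inr ρ m _ _ (r := r)
      (by rw [Function.update_of_ne hlm.symm, hm]), slideOp_apply, Function.update_of_ne hlm,
      Function.update_comm hlm]
    split_ifs
    · rw [map_smul, rho_edge_comm ρ hlm]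
      refine pairing_eq_zero _ _ fun h => ha ?_
      rw [h, rev_rev, r.2]
    · simp

end Ops

section SwapRest

variable (ρ : Alg n lam nu →ₐ[k] Module.End k V) {i : I}

/-- The part of `swapSum` that does not involve the index `q`. -/
def swapRest (i : I) (l q : Fin n) : Module.End k (Conf n i → V) :=
  LinearMap.pi fun x => ∑ m with m ≠ l ∧ m ≠ q ∧ (x m).isRight ∧ (x l).isRight,
    LinearMap.proj x ∘ₗ permOp ρ i (Equiv.swap m l)

lemma swapRest_apply (l q : Fin n) (f : Conf n i → V) (x : Conf n i) :
    swapRest ρ i l q f x = ∑ m with m ≠ l ∧ m ≠ q ∧ (x m).isRight ∧ (x l).isRight,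
      permOp ρ i (Equiv.swap m l) f x := by
  simp [swapRest, LinearMap.sum_apply]

lemma swapSum_eq {l q : Fin n} (hlq : l ≠ q) (f : Conf n i → V) (x : Conf n i) :
    swapSum ρ i l f x = swapRest ρ i l q f x
      + if (x q).isRight ∧ (x l).isRight then permOp ρ i (Equiv.swap q l) f x else 0 := by
  rw [swapSum_apply, swapRest_apply, Finset.sum_filter, Finset.sum_filter,
    ← Finset.sum_erase_add _ _ (Finset.mem_univ q)]
  congr 1
  · rw [← Finset.sum_erase_add (a := q) Finset.univ _ (Finset.mem_univ q)]
    simp only [ne_eq, not_true_eq_false, false_and, and_false, if_false, add_zero]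
    refine Finset.sum_congr rfl fun m hm => ?_
    have : m ≠ q := Finset.ne_of_mem_erase hm
    simp [this]
  · simp [hlq.symm]

lemma swapRest_update {l q : Fin n} (hlq : l ≠ q) (f : Conf n i → V) (x : Conf n i)
    (s : I ⊕ REdge i) :
    swapRest ρ i l q f (Function.update x q s)
      = ∑ m with m ≠ l ∧ m ≠ q ∧ (x m).isRight ∧ (x l).isRight, ρ (perm lam nu (Equiv.swap m l))
          (f (Function.update (permute (Equiv.swap m l)⁻¹ x) q s)) := by
  rw [swapRest_apply]
  refine Finset.sum_congr ?_ ?_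
  · ext m
    simp only [Finset.mem_filter, Finset.mem_univ, true_and, Function.update_of_ne hlq]
    constructor <;> rintro ⟨h1, h2, h3⟩ <;> refine ⟨h1, h2, ?_⟩ <;>
      simpa [Function.update_of_ne h2] using h3
  · intro m hm
    simp only [Finset.mem_filter, Finset.mem_univ, true_and] at hm
    rw [permOp_apply, permute_update_of_fix _ _ _ _
      (Equiv.swap_apply_of_ne_of_ne hm.2.1.symm hlq.symm)]

lemma swapSum_update_inl {l q : Fin n} (hlq : l ≠ q) (f : Conf n i → V) (x : Conf n i) (s : I) :
    swapSum ρ i l f (Function.update x q (Sum.inl s))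
      = ∑ m with m ≠ l ∧ m ≠ q ∧ (x m).isRight ∧ (x l).isRight, ρ (perm lam nu (Equiv.swap m l))
          (f (Function.update (permute (Equiv.swap m l)⁻¹ x) q (Sum.inl s))) := by
  rw [swapSum_eq ρ hlq, swapRest_update ρ hlq, if_neg (by simp), add_zero]

lemma permute_swap_fix {S : Type*} (x : Fin n → S) {l m q : Fin n} (h1 : m ≠ q) (h2 : l ≠ q) :
    permute (Equiv.swap m l)⁻¹ x q = x q := by
  rw [permute_inv_apply, Equiv.swap_apply_of_ne_of_ne h1.symm h2.symm]

lemma swapRest_piOp {l q : Fin n} (hlq : l ≠ q) (f : Conf n i → V) :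
    swapRest ρ i l q (piOp ρ i q f) = piOp ρ i q (swapRest ρ i l q f) := by
  ext x
  rw [swapRest_apply, piOp_apply]
  have key : ∀ m, m ≠ q → permOp ρ i (Equiv.swap m l) (piOp ρ i q f) x
      = if x q = Sum.inl i then ∑ r : REdge i, ρ (edge lam nu q r.1)
          (ρ (perm lam nu (Equiv.swap m l))
            (f (Function.update (permute (Equiv.swap m l)⁻¹ x) q (Sum.inr r)))) else 0 := by
    intro m hm
    rw [permOp_apply, piOp_apply, permute_swap_fix x hm hlq]
    split_ifs
    · simp only [map_sum, rho_perm_edge, Equiv.swap_apply_of_ne_of_ne hm.symm hlq.symm]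
    · simp
  rw [Finset.sum_congr rfl fun m hm => key m (Finset.mem_filter.1 hm).2.2.1]
  split_ifs
  · simp only [swapRest_update ρ hlq, map_sum]
    rw [Finset.sum_comm]
  · simp

lemma swapRest_muOp {l q : Fin n} (hlq : l ≠ q) (f : Conf n i → V) :
    swapRest ρ i l q (muOp ρ i q f) = muOp ρ i q (swapRest ρ i l q f) := by
  ext x
  rcases hq : x q with s | r
  · rw [muOp_apply_inl ρ q _ x hq, swapRest_apply]
    refine Finset.sum_eq_zero fun m hm => ?_
    rw [permOp_apply, muOp_apply_inl ρ q _ _ (s := s)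
      (by rw [permute_swap_fix x (Finset.mem_filter.1 hm).2.2.1 hlq, hq]), map_zero]
  · rw [muOp_apply_inr ρ q _ x hq, swapRest_apply, swapRest_update ρ hlq, map_sum, Finset.smul_sum]
    refine Finset.sum_congr rfl fun m hm => ?_
    have hm := (Finset.mem_filter.1 hm).2.2.1
    rw [permOp_apply, muOp_apply_inr ρ q _ _ (r := r) (by rw [permute_swap_fix x hm hlq, hq]),
      map_smul, rho_perm_edge, Equiv.swap_apply_of_ne_of_ne hm.symm hlq.symm]

lemma tauDown_swapSum (r : REdge i) {l q : Fin n} (hlq : l ≠ q) (f : Conf n i → V) :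
    tauDown k V r q (swapSum ρ i l f) = swapRest ρ i l q (tauDown k V r q f) := by
  ext x
  rw [tauDown_apply, swapSum_update_inl ρ hlq, swapRest_apply, Finset.sum_congr
    (f := fun m => permOp ρ i (Equiv.swap m l) (tauDown k V r q f) x) rfl fun m hm => by
      rw [permOp_apply, tauDown_apply, permute_swap_fix x (Finset.mem_filter.1 hm).2.2.1 hlq]]
  split_ifs <;> simp

lemma tauUp_swapSum (r : REdge i) {l q : Fin n} (hlq : l ≠ q) (f : Conf n i → V) (x : Conf n i) :
    tauUp k V r q (swapSum ρ i l f) x = swapRest ρ i l q (tauUp k V r q f) x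
      + if x q = Sum.inl (tail r.1) ∧ (x l).isRight then
          permOp ρ i (Equiv.swap q l) f (Function.update x q (Sum.inr r)) else 0 := by
  rw [tauUp_apply, swapSum_eq ρ hlq, swapRest_update ρ hlq, swapRest_apply,
    Finset.sum_congr (f := fun m => permOp ρ i (Equiv.swap m l) (tauUp k V r q f) x) rfl
      fun m hm => by rw [permOp_apply, tauUp_apply,
        permute_swap_fix x (Finset.mem_filter.1 hm).2.2.1 hlq]]
  by_cases h : x q = Sum.inl (tail r.1) <;> simp [h, Function.update_of_ne hlq]

lemma slideOp_swapSum (a : DEdge I) {l q : Fin n} (hlq : l ≠ q) (f : Conf n i → V) :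
    slideOp ρ i a q (swapSum ρ i l f) = swapRest ρ i l q (slideOp ρ i a q f) := by
  ext x
  rw [slideOp_apply, swapSum_update_inl ρ hlq, swapRest_apply, map_sum,
    Finset.sum_congr (f := fun m => permOp ρ i (Equiv.swap m l) (slideOp ρ i a q f) x) rfl
      fun m hm => by
        rw [permOp_apply, slideOp_apply, permute_swap_fix x (Finset.mem_filter.1 hm).2.2.1 hlq]]
  split_ifs
  · refine Finset.sum_congr rfl fun m hm => ?_
    rw [rho_perm_edge, Equiv.swap_apply_of_ne_of_ne (Finset.mem_filter.1 hm).2.2.1.symm hlq.symm]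
  · simp

/-- If `g` lives on configurations with a vertex in position `q`, then `q` does not occur. -/
lemma swapSum_eq_swapRest {l q : Fin n} (hlq : l ≠ q) {f : Conf n i → V}
    (hf : ∀ x, (x q).isRight → f x = 0) : swapSum ρ i l f = swapRest ρ i l q f := by
  ext x
  rw [swapSum_eq ρ hlq, add_eq_left]
  split_ifs with h
  · rw [permOp_apply, hf, map_zero]
    rw [permute_inv_apply, Equiv.swap_apply_left]
    exact h.2
  · rfl

lemma piOp_swapSum {l q : Fin n} (hlq : l ≠ q) (f : Conf n i → V) (x : Conf n i) :
    piOp ρ i q (swapSum ρ i l f) x = swapRest ρ i l q (piOp ρ i q f) x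
      + if x q = Sum.inl i ∧ (x l).isRight then
          permOp ρ i (Equiv.swap q l) (piOp ρ i l f) x else 0 := by
  rw [swapRest_piOp ρ hlq, permOp_piOp, Equiv.swap_apply_right, piOp_apply, piOp_apply, piOp_apply]
  by_cases h : x q = Sum.inl i
  · simp only [h, if_true, true_and, swapSum_eq ρ hlq, Function.update_self, Sum.isRight_inr,
      Function.update_of_ne hlq, map_add, Finset.sum_add_distrib]
    congr 1
    split_ifs <;> simp
  · simp [h]

lemma piOp_swapSum_self (l : Fin n) (f : Conf n i → V) (x : Conf n i) (hl : x l = Sum.inl i) :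
    piOp ρ i l (swapSum ρ i l f) x
      = ∑ m with m ≠ l ∧ (x m).isRight, permOp ρ i (Equiv.swap m l) (piOp ρ i m f) x := by
  simp only [permOp_piOp, Equiv.swap_apply_left]
  rw [piOp_apply, if_pos hl]
  have key : ∀ r : REdge i, swapSum ρ i l f (Function.update x l (Sum.inr r))
      = ∑ m with m ≠ l ∧ (x m).isRight,
          permOp ρ i (Equiv.swap m l) f (Function.update x l (Sum.inr r)) := by
    intro r
    rw [swapSum_apply]
    refine Finset.sum_congr ?_ fun _ _ => rfl
    ext m
    simp only [Finset.mem_filter, Finset.mem_univ, true_and, Function.update_self,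
      Sum.isRight_inr, and_true]
    constructor <;> rintro ⟨h1, h2⟩ <;> refine ⟨h1, ?_⟩ <;>
      simpa [Function.update_of_ne h1] using h2
  simp only [key, map_sum]
  rw [Finset.sum_comm]
  refine Finset.sum_congr rfl fun m _ => ?_
  rw [piOp_apply, if_pos hl]

end SwapRest

section Stability

variable {ρ : Alg n lam nu →ₐ[k] Module.End k V} {i : I}

lemma Graded.piOp {f : Conf n i → V} (hf : Graded ρ f) (p : Fin n) : Graded ρ (piOp ρ i p f) := by
  intro x
  rw [piOp_apply]
  split_ifs with h
  · rw [map_sum]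
    refine Finset.sum_congr rfl fun r _ => rho_vtx_edge ρ (hf _) (by simp [src]) ?_
    rw [src_update, Function.update_idem, r.2, eq_comm, Function.update_eq_iff]
    simp [src, h]
  · simp

lemma Graded.muOp {f : Conf n i → V} (hf : Graded ρ f) (p : Fin n) : Graded ρ (muOp ρ i p f) := by
  intro x
  rcases h : x p with s | r
  · rw [muOp_apply_inl ρ p f x h, map_zero]
  · rw [muOp_apply_inr ρ p f x h, map_smul, rho_vtx_edge ρ (hf _)]
    · simp [src, tail_rev, r.2]
    · rw [src_update, Function.update_idem, head_rev, eq_comm, Function.update_eq_iff]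
      simp [src, h]

lemma Graded.permOp {f : Conf n i → V} (hf : Graded ρ f) (σ : Equiv.Perm (Fin n)) :
    Graded ρ (permOp ρ i σ f) := by
  intro x
  rw [permOp_apply]
  exact rho_vtx_perm ρ (hf _) (by rw [← src_permute, permute_permute_inv])

lemma Graded.tauUp {f : Conf n i → V} (hf : Graded ρ f) (r : REdge i) (l : Fin n) :
    Graded ρ (tauUp k V r l f) := by
  intro x
  rw [tauUp_apply]
  split_ifs with h
  · have hs : src x = src (Function.update x l (Sum.inr r)) := by
      rw [src_update, eq_comm, Function.update_eq_iff]
      simp [src, h]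
    rw [hs]; exact hf _
  · simp

lemma Graded.tauDown {f : Conf n i → V} (hf : Graded ρ f) (r : REdge i) (l : Fin n) :
    Graded ρ (tauDown k V r l f) := by
  intro x
  rw [tauDown_apply]
  split_ifs with h
  · have hs : src x = src (Function.update x l (Sum.inl (tail r.1))) := by
      rw [src_update, eq_comm, Function.update_eq_iff]
      simp [src, h]
    rw [hs]; exact hf _
  · simp

lemma Graded.slideOp {f : Conf n i → V} (hf : Graded ρ f) (a : DEdge I) (l : Fin n) :
    Graded ρ (slideOp ρ i a l f) := by
  intro x
  rw [slideOp_apply]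
  split_ifs with h
  · refine rho_vtx_edge ρ (hf _) (by simp [src]) ?_
    rw [src_update, Function.update_idem, eq_comm, Function.update_eq_iff]
    simp [src, h]
  · simp

lemma Graded.swapSum {f : Conf n i → V} (hf : Graded ρ f) (l : Fin n) :
    Graded ρ (swapSum ρ i l f) := by
  intro x
  rw [swapSum_apply, map_sum]
  exact Finset.sum_congr rfl fun m _ => hf.permOp _ x

lemma Graded.thetaOp {f : Conf n i → V} (hf : Graded ρ f) (r : REdge i) (l : Fin n) :
    Graded ρ (thetaOp ρ r l f) := by
  intro x
  have h1 := hf.tauDown r l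
  have h2 := (h1.piOp l).muOp l x
  have h3 := h1.swapSum l x
  rw [thetaOp_apply]
  simp [h1 x, h2, h3]

lemma mem_reflection {f : Conf n i → V} : f ∈ reflection ρ i ↔ Graded ρ f ∧
    (∀ x, (∃ m, x m = Sum.inl i) → f x = 0) ∧ ∀ p, piOp ρ i p f = 0 := Iff.rfl

lemma vtxOp_mem (j : Fin n → I) {f : Conf n i → V} (hf : f ∈ reflection ρ i) :
    vtxOp k V i j f ∈ reflection ρ i := by
  obtain ⟨h1, h2, h3⟩ := hf
  refine ⟨fun x => ?_, fun x hx => ?_, fun p => ?_⟩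
  · rw [vtxOp_apply]; split_ifs
    · exact h1 x
    · simp
  · rw [vtxOp_apply, h2 x hx, ite_self]
  · ext x
    have h := congrFun (h3 p) x
    rw [piOp_apply] at h ⊢
    split_ifs at h ⊢ with hp
    · have hb : ∀ r : REdge i, base (Function.update x p (Sum.inr r)) = base x := by
        intro r
        rw [base_update, Function.update_eq_iff]
        simp [base, hp]
      by_cases hj : base x = j
      · simp only [vtxOp_apply, hb, hj, if_true]; exact h
      · simp [vtxOp_apply, hb, hj]
    · rfl

lemma permOp_mem (σ : Equiv.Perm (Fin n)) {f : Conf n i → V} (hf : f ∈ reflection ρ i) :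
    permOp ρ i σ f ∈ reflection ρ i := by
  obtain ⟨h1, h2, h3⟩ := hf
  refine ⟨Graded.permOp h1 σ, fun x ⟨m, hm⟩ => ?_, fun p => ?_⟩
  · rw [permOp_apply, h2, map_zero]
    exact ⟨σ⁻¹ m, by rw [permute_inv_apply, ← hm]; simp⟩
  · have : p = σ (σ⁻¹ p) := by simp
    rw [this, ← permOp_piOp, h3, map_zero]

lemma tauUp_mem (hi : ∀ a : DEdge I, head a = i → tail a ≠ i) (r : REdge i) (l : Fin n)
    {f : Conf n i → V} (hf : f ∈ reflection ρ i) : tauUp k V r l f ∈ reflection ρ i := by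
  obtain ⟨h1, h2, h3⟩ := hf
  refine ⟨Graded.tauUp h1 r l, fun x ⟨m, hm⟩ => ?_, fun p => ?_⟩
  · rw [tauUp_apply]
    split_ifs with h
    · refine h2 _ ⟨m, ?_⟩
      rw [Function.update_of_ne, hm]
      rintro rfl
      exact hi _ r.2 (Sum.inl.inj (h.symm.trans hm))
    · rfl
  · by_cases hp : l = p
    · subst hp
      ext x
      rw [piOp_apply]
      simp [tauUp_apply]
    · rw [← tauUp_piOp ρ r hp, h3, map_zero]

lemma slideOp_mem (a : DEdge I) (ha : tail a ≠ i) (ha' : head a ≠ i) (l : Fin n)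
    {f : Conf n i → V} (hf : f ∈ reflection ρ i) : slideOp ρ i a l f ∈ reflection ρ i := by
  obtain ⟨h1, h2, h3⟩ := hf
  refine ⟨Graded.slideOp h1 a l, fun x ⟨m, hm⟩ => ?_, fun p => ?_⟩
  · rw [slideOp_apply]
    split_ifs with h
    · rw [h2, map_zero]
      refine ⟨m, ?_⟩
      rw [Function.update_of_ne, hm]
      rintro rfl
      exact ha' (Sum.inl.inj (h.symm.trans hm))
    · rfl
  · by_cases hp : l = p
    · subst hp
      ext x
      rw [piOp_apply]
      simp [slideOp_apply]
    · rw [← slideOp_piOp ρ a ha hp, h3, map_zero]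

lemma src_ne (hi : ∀ a : DEdge I, head a = i → tail a ≠ i) {x : Conf n i} {m : Fin n}
    (h : x m ≠ Sum.inl i) : src x m ≠ i := by
  rcases hm : x m with s | r
  · rw [hm] at h; simp only [src, hm]; exact fun e => h (congrArg Sum.inl e)
  · simp only [src, hm]; exact hi _ r.2

lemma thetaOp_mem (hi : ∀ a : DEdge I, head a = i → tail a ≠ i) (r : REdge i) (l : Fin n)
    {f : Conf n i → V} (hf : f ∈ reflection ρ i) : thetaOp ρ r l f ∈ reflection ρ i := by
  obtain ⟨h1, h2, h3⟩ := hf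
  have hg : Graded ρ (tauDown k V r l f) := Graded.tauDown h1 r l
  have hd : ∀ y : Conf n i, (∃ m, y m = Sum.inl i) → tauDown k V r l f y = 0 := by
    rintro y ⟨m, hm⟩
    rw [tauDown_apply]
    split_ifs with h
    · refine h2 _ ⟨m, ?_⟩
      rw [Function.update_of_ne, hm]
      rintro rfl
      rw [hm] at h; cases h
    · rfl
  have hsupp : ∀ x, (∃ m, x m = Sum.inl i) → thetaOp ρ r l f x = 0 := by
    rintro x ⟨m, hm⟩
    rw [thetaOp_apply]
    have e1 := hd x ⟨m, hm⟩
    have e2 : muOp ρ i l (piOp ρ i l (tauDown k V r l f)) x = 0 := by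
      rcases hl : x l with s | r'
      · exact muOp_apply_inl ρ l _ x hl
      · have hml : m ≠ l := by rintro rfl; rw [hm] at hl; cases hl
        rw [muOp_apply_inr ρ l _ x hl, piOp_apply, if_pos (by simp), Finset.sum_eq_zero]
        · simp
        · intro r'' _
          rw [hd, map_zero]
          exact ⟨m, by simp [hml, hm]⟩
    have e3 : swapSum ρ i l (tauDown k V r l f) x = 0 := by
      rw [swapSum_apply]
      refine Finset.sum_eq_zero fun q _ => ?_
      rw [permOp_apply, hd, map_zero]
      exact ⟨Equiv.swap q l m, by rw [permute_inv_apply, Equiv.swap_apply_self, hm]⟩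
    simp [e1, e2, e3]
  refine ⟨Graded.thetaOp h1 r l, hsupp, fun p => ?_⟩
  by_cases hp : p = l
  · subst hp
    ext x
    by_cases hx : x p = Sum.inl i
    · by_cases hm : ∃ m, m ≠ p ∧ x m = Sum.inl i
      · obtain ⟨m, hmp, hm⟩ := hm
        rw [piOp_apply, if_pos hx]
        refine Finset.sum_eq_zero fun r' _ => ?_
        rw [hsupp, map_zero]
        exact ⟨m, by simp [hmp, hm]⟩
      · push Not at hm
        rw [thetaOp_apply, map_add, map_add, map_neg, map_smul, map_smul]
        simp only [Pi.add_apply, Pi.neg_apply, Pi.smul_apply, Pi.zero_apply]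
        rw [piOp_muOp_self ρ (hg.piOp p) x hx fun m hmp => src_ne hi (hm m hmp),
          piOp_swapSum_self ρ p _ x hx, neg_add_cancel, zero_add, Finset.sum_eq_zero, smul_zero]
        intro m hmp
        have hmp := (Finset.mem_filter.1 hmp).2.1
        rw [← tauDown_piOp ρ r hmp.symm, h3]
        simp
    · rw [piOp_apply, if_neg hx]; rfl
  · have e : piOp ρ i p (tauDown k V r l f) = 0 := by
      rw [← tauDown_piOp ρ r (Ne.symm hp), h3, map_zero]
    ext x
    rw [thetaOp_apply, map_add, map_add, map_neg, map_smul, map_smul]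
    simp only [Pi.add_apply, Pi.neg_apply, Pi.smul_apply, Pi.zero_apply]
    rw [piOp_muOp ρ hp (hg.piOp l), piOp_comm ρ hi hp, piOp_swapSum ρ (Ne.symm hp), e]
    simp

lemma edgeOp_mem (hi : ∀ a : DEdge I, head a = i → tail a ≠ i) (l : Fin n) (a : DEdge I)
    {f : Conf n i → V} (hf : f ∈ reflection ρ i) : edgeOp ρ i l a f ∈ reflection ρ i := by
  unfold edgeOp
  split_ifs with h1 h2
  · exact Submodule.smul_mem _ _ (tauUp_mem hi _ l hf)
  · exact thetaOp_mem hi _ l hf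
  · exact slideOp_mem a h1 h2 l hf

end Stability

section Relations

variable {ρ : Alg n lam nu →ₐ[k] Module.End k V} {i : I}

lemma permute_swap_apply {S : Type*} (x : Fin n → S) (l m q : Fin n) :
    permute (Equiv.swap l m) x q = x (Equiv.swap l m q) := rfl

lemma swapRest_swapRest {l m : Fin n} (hlm : l ≠ m) (g : Conf n i → V) (x : Conf n i)
    (hl : (x l).isRight) (hm : (x m).isRight) :
    swapRest ρ i l m (swapRest ρ i m l g) x
      = ∑ p with p ≠ l ∧ p ≠ m ∧ (x p).isRight, ∑ q with q ≠ l ∧ q ≠ m ∧ (x q).isRight,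
          permOp ρ i (Equiv.swap p l * Equiv.swap q m) g x := by
  rw [swapRest_apply]
  refine Finset.sum_congr (by ext; simp [hl]) fun p hp => ?_
  simp only [Finset.mem_filter, Finset.mem_univ, true_and] at hp
  rw [permOp_apply, swapRest_apply, map_sum]
  refine Finset.sum_congr ?_ fun q _ => ?_
  · ext q
    simp only [Finset.mem_filter, Finset.mem_univ, true_and]
    rw [permute_swap_fix x hp.2.1 hlm]
    by_cases h1 : q = l
    · simp [h1]
    · by_cases h2 : q = p
      · subst h2
        simp [permute_inv_apply, permute_swap_apply, hl, hm, hp]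
      · simp [permute_inv_apply, permute_swap_apply, Equiv.swap_apply_of_ne_of_ne h2 h1, h1, hm]
  · rw [permOp_mul]; rfl

lemma swapRest_swapRest_comm {l m : Fin n} (hlm : l ≠ m) {g : Conf n i → V}
    (hg : ∀ x, ¬ ((x l).isRight ∧ (x m).isRight) → g x = 0) :
    swapRest ρ i l m (swapRest ρ i m l g) + permOp ρ i (Equiv.swap l m) (swapRest ρ i m l g)
      = swapRest ρ i m l (swapRest ρ i l m g)
        + permOp ρ i (Equiv.swap l m) (swapRest ρ i l m g) := by
  ext x
  have hR : ∀ {l m : Fin n}, l ≠ m → (∀ x, ¬ ((x l).isRight ∧ (x m).isRight) → g x = 0) →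
      ∀ x, ¬ ((x l).isRight ∧ (x m).isRight) → swapRest ρ i m l g x = 0 := by
    intro l m hlm hg x hx
    rw [swapRest_apply]
    refine Finset.sum_eq_zero fun p hp => ?_
    simp only [Finset.mem_filter, Finset.mem_univ, true_and] at hp
    rw [permOp_apply, hg, map_zero]
    rw [permute_swap_fix x hp.2.1 hlm.symm]
    exact fun h => hx ⟨h.1, hp.2.2.2⟩
  have hS : ∀ {h : Conf n i → V}, (∀ x, ¬ ((x l).isRight ∧ (x m).isRight) → h x = 0) →
      ∀ x, ¬ ((x l).isRight ∧ (x m).isRight) → permOp ρ i (Equiv.swap l m) h x = 0 := by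
    intro h hh x hx
    rw [permOp_apply, hh, map_zero]
    simp only [permute_inv_apply, Equiv.swap_apply_left, Equiv.swap_apply_right]
    exact fun h => hx h.symm
  have hg' : ∀ x, ¬ ((x m).isRight ∧ (x l).isRight) → g x = 0 := fun x hx =>
    hg x fun h => hx h.symm
  simp only [Pi.add_apply]
  by_cases hx : (x l).isRight ∧ (x m).isRight
  · obtain ⟨hl, hm⟩ := hx
    have hT : ∀ {l m : Fin n}, l ≠ m → (x l).isRight → (x m).isRight →
        permOp ρ i (Equiv.swap l m) (swapRest ρ i m l g) x
        = ∑ q with q ≠ l ∧ q ≠ m ∧ (x q).isRight,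
            permOp ρ i (Equiv.swap l m * Equiv.swap q m) g x := by
      intro l m hlm hl hm
      rw [permOp_apply, swapRest_apply, map_sum]
      refine Finset.sum_congr ?_ fun q _ => ?_
      · ext q
        simp only [Finset.mem_filter, Finset.mem_univ, true_and]
        by_cases h1 : q = l
        · simp [h1]
        · by_cases h2 : q = m
          · simp [h2]
          · simp [permute_inv_apply, permute_swap_apply, Equiv.swap_apply_of_ne_of_ne h1 h2, h1, h2, hl]
      · rw [permOp_mul]; rfl
    have hT' := hT hlm.symm hm hl
    rw [Equiv.swap_comm m l] at hT'
    rw [swapRest_swapRest hlm g x hl hm, swapRest_swapRest hlm.symm g x hm hl, hT hlm hl hm, hT']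
    have hD : (Finset.univ.filter fun q => q ≠ m ∧ q ≠ l ∧ (x q).isRight = true)
        = Finset.univ.filter fun q => q ≠ l ∧ q ≠ m ∧ (x q).isRight = true := by
      ext q; simp only [Finset.mem_filter, Finset.mem_univ, true_and]; tauto
    rw [hD]
    set D := Finset.univ.filter fun q => q ≠ l ∧ q ≠ m ∧ (x q).isRight = true with hDdef
    rw [Finset.sum_comm (s := D) (t := D)
      (f := fun p q => permOp ρ i (Equiv.swap p m * Equiv.swap q l) g x),
      ← Finset.sum_add_distrib, ← Finset.sum_add_distrib]
    refine Finset.sum_congr rfl fun p hp => ?_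
    simp only [hDdef, Finset.mem_filter, Finset.mem_univ, true_and] at hp
    rw [← Finset.sum_erase_add D _ (a := p) (by simp [hDdef, hp]),
      ← Finset.sum_erase_add D (fun q => permOp ρ i (Equiv.swap q m * Equiv.swap p l) g x) (a := p)
        (by simp [hDdef, hp]), add_assoc, add_assoc]
    congr 1
    · refine Finset.sum_congr rfl fun q hq => ?_
      have hq1 := Finset.ne_of_mem_erase hq
      have hq2 := Finset.mem_of_mem_erase hq
      simp only [hDdef, Finset.mem_filter, Finset.mem_univ, true_and] at hq2
      have : Equiv.swap p l * Equiv.swap q m = Equiv.swap q m * Equiv.swap p l := by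
        refine Equiv.Perm.Disjoint.commute ?_
        rw [Equiv.Perm.disjoint_iff_disjoint_support, Equiv.Perm.support_swap hp.1,
          Equiv.Perm.support_swap hq2.2.1]
        simp only [Finset.disjoint_left, Finset.mem_insert, Finset.mem_singleton]
        rintro a (rfl | rfl) (h | h)
        · exact hq1 h.symm
        · exact hp.2.1 h
        · exact hq2.1 h.symm
        · exact hlm h
      rw [this]
    · have e1 : Equiv.swap p l * Equiv.swap p m = Equiv.swap l m * Equiv.swap p l := by
        rw [Equiv.mul_swap_eq_swap_mul, Equiv.swap_apply_left,
          Equiv.swap_apply_of_ne_of_ne hp.2.1.symm hlm.symm]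
      have e2 : Equiv.swap l m * Equiv.swap p m = Equiv.swap p m * Equiv.swap p l := by
        rw [Equiv.mul_swap_eq_swap_mul (Equiv.swap p m), Equiv.swap_apply_left,
          Equiv.swap_apply_of_ne_of_ne hp.1.symm hlm, Equiv.swap_comm m l]
      rw [e1, e2, add_comm]
  · have h1 : swapRest ρ i l m (swapRest ρ i m l g) x = 0 := by
      rw [swapRest_apply]
      refine Finset.sum_eq_zero fun p hp => ?_
      simp only [Finset.mem_filter, Finset.mem_univ, true_and] at hp
      rw [permOp_apply, hR hlm hg, map_zero]
      rw [permute_swap_fix x hp.2.1 hlm]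
      exact fun h => hx ⟨hp.2.2.2, h.2⟩
    have h2 : swapRest ρ i m l (swapRest ρ i l m g) x = 0 := by
      rw [swapRest_apply]
      refine Finset.sum_eq_zero fun p hp => ?_
      simp only [Finset.mem_filter, Finset.mem_univ, true_and] at hp
      rw [permOp_apply, hR hlm.symm hg', map_zero]
      rw [permute_swap_fix x hp.2.1 hlm.symm]
      exact fun h => hx ⟨h.2, hp.2.2.2⟩
    rw [h1, h2, hS (hR hlm hg) x hx, hS (fun y hy => hR hlm.symm hg' y fun h => hy h.symm) x hx]

lemma muPi_muPi {l m : Fin n} (hlm : l ≠ m) {g : Conf n i → V}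
    (hgr : Graded ρ g) (hg : ∀ x, ¬ ((x l).isRight ∧ (x m).isRight) → g x = 0) :
    muOp ρ i l (piOp ρ i l (muOp ρ i m (piOp ρ i m g)))
      = muOp ρ i l (muOp ρ i m (piOp ρ i l (piOp ρ i m g)))
        - nu • permOp ρ i (Equiv.swap l m) (muOp ρ i m (piOp ρ i m g)) := by
  have key : piOp ρ i l (muOp ρ i m (piOp ρ i m g)) = muOp ρ i m (piOp ρ i l (piOp ρ i m g))
      - nu • permOp ρ i (Equiv.swap l m) (piOp ρ i m g) := by
    ext x
    rw [piOp_muOp ρ hlm (hgr.piOp m)]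
    simp only [Pi.sub_apply, Pi.smul_apply]
    split_ifs with h
    · rfl
    · rw [permOp_apply, piOp_apply]
      have e : permute (Equiv.swap l m)⁻¹ x m = x l := by simp [permute_inv_apply, permute_swap_apply]
      have e' : permute (Equiv.swap l m)⁻¹ x l = x m := by simp [permute_inv_apply, permute_swap_apply]
      rw [e]
      by_cases hx : x l = Sum.inl i
      · rw [if_pos hx, Finset.sum_eq_zero, map_zero]
        intro r _
        rw [hg, map_zero]
        rw [Function.update_of_ne hlm, e']
        exact fun hh => h ⟨hx, hh.1⟩
      · rw [if_neg hx, map_zero]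
  rw [key, map_sub, map_smul, permOp_muOp, Equiv.swap_apply_right]

lemma thetaOp_thetaOp (hi : ∀ a : DEdge I, head a = i → tail a ≠ i) (a b : REdge i) {l m : Fin n}
    (hlm : l ≠ m) {f : Conf n i → V} (hf : Graded ρ f) :
    thetaOp ρ a l (thetaOp ρ b m f) = thetaOp ρ b m (thetaOp ρ a l f) := by
  have step : ∀ (a b : REdge i) {l m : Fin n}, l ≠ m →
      thetaOp ρ a l (thetaOp ρ b m f)
        = (lam i * lam i) • tauDown k V a l (tauDown k V b m f)
          - lam i • (muOp ρ i m (piOp ρ i m (tauDown k V a l (tauDown k V b m f)))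
            + nu • swapRest ρ i m l (tauDown k V a l (tauDown k V b m f))
            + muOp ρ i l (piOp ρ i l (tauDown k V a l (tauDown k V b m f)))
            + nu • swapRest ρ i l m (tauDown k V a l (tauDown k V b m f))
            + nu • permOp ρ i (Equiv.swap l m) (tauDown k V a l (tauDown k V b m f)))
          + muOp ρ i l (muOp ρ i m (piOp ρ i l (piOp ρ i m
              (tauDown k V a l (tauDown k V b m f)))))
          + nu • (swapRest ρ i m l (muOp ρ i l (piOp ρ i l
                (tauDown k V a l (tauDown k V b m f))))
              + swapRest ρ i l m (muOp ρ i m (piOp ρ i m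
                (tauDown k V a l (tauDown k V b m f)))))
          + (nu * nu) • (swapRest ρ i l m (swapRest ρ i m l
                (tauDown k V a l (tauDown k V b m f)))
              + permOp ρ i (Equiv.swap l m) (swapRest ρ i m l
                (tauDown k V a l (tauDown k V b m f)))) := by
    intro a b l m hlm
    set G := tauDown k V a l (tauDown k V b m f) with hG
    have hGg : Graded ρ G := (Graded.tauDown hf b m).tauDown a l
    have hGs : ∀ x, ¬ ((x l).isRight ∧ (x m).isRight) → G x = 0 := by
      intro x hx
      rw [hG, tauDown_apply]
      split_ifs with h1
      · rw [tauDown_apply]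
        split_ifs with h2
        · rw [Function.update_of_ne hlm.symm] at h2
          exact absurd ⟨by simp [h1], by simp [h2]⟩ hx
        · rfl
      · rfl
    have hH : tauDown k V a l (thetaOp ρ b m f) = -(lam i • G) + muOp ρ i m (piOp ρ i m G)
        + nu • swapRest ρ i m l G := by
      rw [thetaOp_apply, map_add, map_add, map_neg, map_smul, map_smul, tauDown_muOp ρ a hlm,
        tauDown_piOp ρ a hlm, tauDown_swapSum ρ a hlm.symm]
    have hHs : ∀ x, ¬ ((x l).isRight ∧ (x m).isRight) →
        (-(lam i • G) + muOp ρ i m (piOp ρ i m G) + nu • swapRest ρ i m l G) x = 0 := by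
      intro x hx
      rw [← hH, tauDown_apply]
      split_ifs with h1
      · have hm : ¬ (x m).isRight := fun h => hx ⟨by simp [h1], h⟩
        have hm' : Function.update x l (Sum.inl (tail a.1)) m = x m :=
          Function.update_of_ne hlm.symm _ _
        rw [thetaOp_apply]
        have e1 : tauDown k V b m f (Function.update x l (Sum.inl (tail a.1))) = 0 := by
          rw [tauDown_apply, if_neg]
          intro h; rw [hm'] at h; exact hm (by simp [h])
        have e2 : ∀ h, muOp ρ i m h (Function.update x l (Sum.inl (tail a.1))) = 0 := by
          intro h
          rcases hxm : x m with s | r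
          · exact muOp_apply_inl ρ m _ _ (hm'.trans hxm)
          · exact absurd (by simp [hxm]) hm
        have e3 : ∀ h, swapSum ρ i m h (Function.update x l (Sum.inl (tail a.1))) = 0 := by
          intro h
          rw [swapSum_apply]
          refine Finset.sum_eq_zero fun q hq => ?_
          have := (Finset.mem_filter.1 hq).2.2.2
          rw [hm'] at this
          exact absurd this hm
        simp [e1, e2, e3]
      · rfl
    rw [thetaOp_apply ρ a l, hH]
    have hsw : swapSum ρ i l (-(lam i • G) + muOp ρ i m (piOp ρ i m G) + nu • swapRest ρ i m l G)
        = swapRest ρ i l m (-(lam i • G) + muOp ρ i m (piOp ρ i m G) + nu • swapRest ρ i m l G)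
          + permOp ρ i (Equiv.swap l m)
            (-(lam i • G) + muOp ρ i m (piOp ρ i m G) + nu • swapRest ρ i m l G) := by
      ext x
      rw [swapSum_eq ρ hlm, Pi.add_apply, Equiv.swap_comm m l]
      congr 1
      split_ifs with h
      · rfl
      · rw [permOp_apply, hHs, map_zero]
        simpa [permute_inv_apply, permute_swap_apply] using h
    rw [hsw]
    simp only [map_add, map_neg, map_smul, muPi_muPi hlm hGg hGs]
    rw [← swapRest_piOp ρ hlm.symm, ← swapRest_muOp ρ hlm.symm]
    module
  rw [step a b hlm, step b a hlm.symm, tauDown_tauDown b a hlm.symm, Equiv.swap_comm m l,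
    muOp_comm ρ hi hlm.symm, piOp_comm ρ hi hlm.symm]
  rw [swapRest_swapRest_comm (ρ := ρ) hlm]
  · module
  · intro x hx
    rw [tauDown_apply]
    split_ifs with h1
    · rw [tauDown_apply]
      split_ifs with h2
      · rw [Function.update_of_ne hlm.symm] at h2
        exact absurd ⟨by simp [h1], by simp [h2]⟩ hx
      · rfl
    · rfl

lemma edgeOp_rev (l : Fin n) (r : REdge i) :
    edgeOp ρ i l (rev r.1) = sgn k r.1 • tauUp k V r l := by
  have h : tail (rev r.1) = i := by rw [tail_rev, r.2]
  rw [edgeOp, dif_pos h]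
  simp only [rev_rev]

lemma edgeOp_head (hi : ∀ a : DEdge I, head a = i → tail a ≠ i) (l : Fin n) (r : REdge i) :
    edgeOp ρ i l r.1 = thetaOp ρ r l := by
  rw [edgeOp, dif_neg (hi _ r.2), dif_pos r.2]

lemma edgeOp_slide (l : Fin n) (a : DEdge I) (h1 : tail a ≠ i) (h2 : head a ≠ i) :
    edgeOp ρ i l a = slideOp ρ i a l := by
  rw [edgeOp, dif_neg h1, dif_neg h2]

lemma slideOp_thetaOp (a : DEdge I) (h1 : tail a ≠ i) (h2 : head a ≠ i) (b : REdge i)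
    {l m : Fin n} (hlm : l ≠ m) (f : Conf n i → V) :
    slideOp ρ i a l (thetaOp ρ b m f) = thetaOp ρ b m (slideOp ρ i a l f) := by
  rw [thetaOp_apply, thetaOp_apply, map_add, map_add, map_neg, map_smul, map_smul,
    slideOp_muOp ρ a h2 hlm, slideOp_piOp ρ a h1 hlm, slideOp_swapSum ρ a hlm.symm,
    ← slideOp_tauDown ρ a b hlm, swapSum_eq_swapRest ρ hlm.symm]
  intro x hx
  rw [slideOp_apply, if_neg]
  intro h; rw [h] at hx; simp at hx

lemma slideOp_slideOp (a b : DEdge I) (ha : tail a ≠ i) (ha' : head a ≠ i) {l m : Fin n}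
    (hlm : l ≠ m) {f : Conf n i → V} (hf : Graded ρ f)
    (hs : ∀ x, ¬ (base x l = tail a ∧ base x m = tail b) → f x = 0) :
    slideOp ρ i a l (slideOp ρ i b m f) = slideOp ρ i b m (slideOp ρ i a l f)
      + (nu * pairing k a b) • permOp ρ i (Equiv.swap l m) f := by
  ext x
  simp only [slideOp_apply, Pi.add_apply, Pi.smul_apply, Function.update_of_ne hlm,
    Function.update_of_ne hlm.symm, permOp_apply]
  by_cases h : x l = Sum.inl (head a) ∧ x m = Sum.inl (head b)
  · obtain ⟨h1, h2⟩ := h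
    simp only [h1, h2, if_true]
    rw [Function.update_comm hlm, rho_edge_edge ρ hlm (hf _)]
    · congr 1
      by_cases hp : a = rev b
      · rw [permute_swap x hlm, h1, h2, hp, head_rev, tail_rev, Function.update_comm hlm]
      · rw [pairing_eq_zero _ _ hp]; simp
    · simp [src_update, hlm]
    · simp [src_update, hlm.symm]
  · have e : (nu * pairing k a b) • ρ (perm lam nu (Equiv.swap l m))
        (f (permute (Equiv.swap l m)⁻¹ x)) = 0 := by
      by_cases hp : a = rev b
      · rw [hs, map_zero, smul_zero]
        rw [hp, tail_rev]
        rw [hp, tail_rev] at ha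
        rw [hp, head_rev] at h ha'
        rintro ⟨e1, e2⟩
        simp only [base, permute_inv_apply, Equiv.swap_apply_left, Equiv.swap_apply_right] at e1 e2
        apply h
        rcases hx1 : x l with s | r <;> rcases hx2 : x m with s' | r' <;>
          simp_all
      · rw [pairing_eq_zero _ _ hp]; simp
    rw [e, add_zero]
    by_cases h1 : x l = Sum.inl (head a)
    · have h2 : ¬ x m = Sum.inl (head b) := fun h2 => h ⟨h1, h2⟩
      simp [h1, h2]
    · simp [h1]

lemma tauUp_thetaOp (hi : ∀ a : DEdge I, head a = i → tail a ≠ i) (r b : REdge i)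
    {l m : Fin n} (hlm : l ≠ m) {f : Conf n i → V}
    (hf : ∀ x, (∃ m, x m = Sum.inl i) → f x = 0)
    (hs : ∀ x, ¬ (base x l = i ∧ base x m = tail b.1) → f x = 0) :
    tauUp k V r l (thetaOp ρ b m f) = thetaOp ρ b m (tauUp k V r l f)
      + (nu * if r = b then 1 else 0) • permOp ρ i (Equiv.swap l m) f := by
  ext x
  have e1 : swapSum ρ i m (tauUp k V r l (tauDown k V b m f))
      = swapRest ρ i m l (tauUp k V r l (tauDown k V b m f)) := by
    refine swapSum_eq_swapRest ρ hlm.symm fun y hy => ?_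
    rw [tauUp_apply, if_neg]
    intro h; rw [h] at hy; simp at hy
  rw [thetaOp_apply, map_add, map_add, map_neg, map_smul, map_smul, tauUp_muOp ρ r hlm,
    tauUp_piOp ρ r hlm, Pi.add_apply, Pi.add_apply, thetaOp_apply, ← tauUp_tauDown r b hlm, e1]
  simp only [Pi.add_apply, Pi.smul_apply]
  rw [tauUp_swapSum ρ r hlm.symm, smul_add, ← add_assoc]
  congr 1
  rw [permOp_apply, permOp_apply, tauDown_apply]
  have e2 : permute (Equiv.swap l m)⁻¹ (Function.update x l (Sum.inr r)) m = Sum.inr r := by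
    simp [permute_inv_apply, permute_swap_apply]
  have e3 : permute (Equiv.swap l m)⁻¹ (Function.update x l (Sum.inr r))
      = Function.update (permute (Equiv.swap l m)⁻¹ x) m (Sum.inr r) := by
    have := permute_update (Equiv.swap l m) x m (Sum.inr r)
    rwa [Equiv.swap_apply_right] at this
  rw [e2]
  by_cases hrb : r = b
  · subst hrb
    rw [if_pos rfl, if_pos rfl, mul_one, e3, Function.update_idem]
    by_cases h : x l = Sum.inl (tail r.1) ∧ (x m).isRight
    · rw [if_pos h]
      have : Function.update (permute (Equiv.swap l m)⁻¹ x) m (Sum.inl (tail r.1))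
          = permute (Equiv.swap l m)⁻¹ x := by
        rw [Function.update_eq_iff]; simp [permute_inv_apply, permute_swap_apply, h.1]
      rw [this]
    · rw [if_neg h]
      congr 1
      by_cases hb : base (permute (Equiv.swap l m)⁻¹ x) l = i
          ∧ base (permute (Equiv.swap l m)⁻¹ x) m = tail r.1
      · simp only [base, permute_inv_apply, Equiv.swap_apply_left, Equiv.swap_apply_right] at hb
        rw [hf, map_zero]
        refine ⟨l, ?_⟩
        rw [permute_inv_apply, Equiv.swap_apply_left]
        have hr := hi _ r.2
        rcases hx1 : x l with s | r1 <;> rcases hx2 : x m with s' | r2 <;> simp_all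
      · rw [hs _ hb, map_zero]
  · have : ¬ ((Sum.inr r : I ⊕ REdge i) = Sum.inr b) := fun h => hrb (Sum.inr.inj h)
    rw [if_neg this, if_neg hrb]
    simp

end Relations

section Final

variable {ρ : Alg n lam nu →ₐ[k] Module.End k V} {i : I}

lemma edgeOp_edgeOp (hi : ∀ a : DEdge I, head a = i → tail a ≠ i) (a b : DEdge I)
    {l m : Fin n} (hlm : l ≠ m) {f : Conf n i → V} (hf : f ∈ reflection ρ i)
    (hs : ∀ x, ¬ (base x l = tail a ∧ base x m = tail b) → f x = 0) :
    edgeOp ρ i l a (edgeOp ρ i m b f) = edgeOp ρ i m b (edgeOp ρ i l a f)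
      + (nu * pairing k a b) • permOp ρ i (Equiv.swap l m) f := by
  -- the three pairs of cases that are not symmetric
  have h12 : ∀ (a : DEdge I) (b : REdge i) {l m : Fin n}, l ≠ m → tail a ≠ i → head a ≠ i →
      edgeOp ρ i l a (edgeOp ρ i m (rev b.1) f) = edgeOp ρ i m (rev b.1) (edgeOp ρ i l a f)
        + (nu * pairing k a (rev b.1)) • permOp ρ i (Equiv.swap l m) f := by
    intro a b l m hlm h1 h2
    rw [edgeOp_rev, edgeOp_slide l a h1 h2, pairing_rev_right, if_neg]
    · simp [slideOp_tauUp ρ a b hlm]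
    · rintro rfl; exact h2 b.2
  have h13 : ∀ (a : DEdge I) (b : REdge i) {l m : Fin n}, l ≠ m → tail a ≠ i → head a ≠ i →
      edgeOp ρ i l a (edgeOp ρ i m b.1 f) = edgeOp ρ i m b.1 (edgeOp ρ i l a f)
        + (nu * pairing k a b.1) • permOp ρ i (Equiv.swap l m) f := by
    intro a b l m hlm h1 h2
    rw [edgeOp_head hi, edgeOp_slide l a h1 h2, pairing_eq_zero, slideOp_thetaOp a h1 h2 b hlm]
    · simp
    · rintro rfl; rw [tail_rev] at h1; exact h1 b.2
  have h23 : ∀ (r b : REdge i) {l m : Fin n}, l ≠ m →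
      (∀ x, ¬ (base x l = i ∧ base x m = tail b.1) → f x = 0) →
      edgeOp ρ i l (rev r.1) (edgeOp ρ i m b.1 f) = edgeOp ρ i m b.1 (edgeOp ρ i l (rev r.1) f)
        + (nu * pairing k (rev r.1) b.1) • permOp ρ i (Equiv.swap l m) f := by
    intro r b l m hlm hs
    rw [edgeOp_head hi, edgeOp_rev, pairing_rev_left]
    simp only [LinearMap.smul_apply, map_smul]
    rw [tauUp_thetaOp hi r b hlm hf.2.1 hs, smul_add, smul_smul]
    congr 2
    by_cases h : r = b
    · subst h; simp [mul_comm]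
    · rw [if_neg h, if_neg fun h' => h (Subtype.ext h')]; simp
  -- reversing the roles
  have flip : ∀ {a b : DEdge I} {l m : Fin n},
      (edgeOp ρ i m b (edgeOp ρ i l a f) = edgeOp ρ i l a (edgeOp ρ i m b f)
        + (nu * pairing k b a) • permOp ρ i (Equiv.swap m l) f) →
      edgeOp ρ i l a (edgeOp ρ i m b f) = edgeOp ρ i m b (edgeOp ρ i l a f)
        + (nu * pairing k a b) • permOp ρ i (Equiv.swap l m) f := by
    intro a b l m h
    rw [h, pairing_swap a b, Equiv.swap_comm m l]
    module
  have exR : ∀ a : DEdge I, tail a = i → ∃ r : REdge i, a = rev r.1 := fun a ha =>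
    ⟨⟨rev a, (head_rev a).trans ha⟩, (rev_rev a).symm⟩
  by_cases ha1 : tail a = i
  · obtain ⟨r, rfl⟩ := exR a ha1
    by_cases hb1 : tail b = i
    · obtain ⟨s, rfl⟩ := exR b hb1
      rw [edgeOp_rev, edgeOp_rev, pairing_eq_zero]
      · simp [tauUp_tauUp r s hlm, smul_comm (sgn k r.1)]
      · intro h
        have := congrArg tail h
        rw [tail_rev, tail_rev, head_rev, r.2] at this
        exact hi _ s.2 this.symm
    · by_cases hb2 : head b = i
      · refine h23 r ⟨b, hb2⟩ hlm fun x hx => hs x ?_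
        rw [tail_rev, r.2]; exact hx
      · exact flip (h12 b r hlm.symm hb1 hb2)
  · by_cases ha2 : head a = i
    · by_cases hb1 : tail b = i
      · obtain ⟨s, rfl⟩ := exR b hb1
        refine flip (h23 s ⟨a, ha2⟩ hlm.symm fun x hx => hs x ?_)
        rw [tail_rev, s.2]; exact fun h => hx h.symm
      · by_cases hb2 : head b = i
        · have ea := edgeOp_head (ρ := ρ) hi l ⟨a, ha2⟩
          have eb := edgeOp_head (ρ := ρ) hi m ⟨b, hb2⟩
          simp only at ea eb
          rw [ea, eb, thetaOp_thetaOp hi _ _ hlm hf.1, pairing_eq_zero]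
          · simp
          · rintro rfl; rw [tail_rev] at ha1; exact ha1 hb2
        · exact flip (h13 b ⟨a, ha2⟩ hlm.symm hb1 hb2)
    · by_cases hb1 : tail b = i
      · obtain ⟨s, rfl⟩ := exR b hb1
        exact h12 a s hlm ha1 ha2
      · by_cases hb2 : head b = i
        · exact h13 a ⟨b, hb2⟩ hlm ha1 ha2
        · rw [edgeOp_slide l a ha1 ha2, edgeOp_slide m b hb1 hb2]
          exact slideOp_slideOp a b ha1 ha2 hlm hf.1 hs

lemma ringelForm_single (i j : I) :
    ringelForm (Pi.single i 1) (Pi.single j 1) = (if i = j then 1 else 0)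
      - ∑ a : Quiver.Total I, if a.left = i ∧ a.right = j then 1 else 0 := by
  simp only [ringelForm, Pi.single_apply, mul_ite, mul_one, mul_zero, Finset.sum_ite_eq',
    Finset.mem_univ, if_true, ite_mul, one_mul, zero_mul]
  congr 1
  · simp [eq_comm]
  · refine Finset.sum_congr rfl fun a _ => ?_
    split_ifs <;> simp_all

lemma reflectParam_self (hi : ∀ a : DEdge I, head a = i → tail a ≠ i) :
    reflectParam i lam i = - lam i := by
  have h : ∀ a : Quiver.Total I, ¬ (a.left = i ∧ a.right = i) := fun a ha =>
    hi (Sum.inl a) ha.2 ha.1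
  simp [reflectParam, symForm, ringelForm_single, h]
  ring

lemma reflectParam_ne (j : I) (hj : j ≠ i) :
    reflectParam i lam j
      = lam j + ∑ b : DEdge I, if head b = j ∧ tail b = i then lam i else 0 := by
  have e1 : ∀ a : Quiver.Total I, (head (Sum.inl a : DEdge I) = j ∧ tail (Sum.inl a : DEdge I) = i)
      ↔ (a.left = i ∧ a.right = j) := fun a => and_comm
  have e2 : ∀ a : Quiver.Total I, (head (Sum.inr a : DEdge I) = j ∧ tail (Sum.inr a : DEdge I) = i)
      ↔ (a.left = j ∧ a.right = i) := fun a => Iff.rfl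
  simp only [reflectParam, symForm, ringelForm_single, hj, hj.symm, if_false, Fintype.sum_sum_type,
    e1, e2]
  push_cast
  simp only [add_mul, sub_mul, zero_mul, zero_sub, neg_mul, Finset.sum_mul, ite_mul, one_mul]
  ring

lemma edgeOp_relI (hi : ∀ a : DEdge I, head a = i → tail a ≠ i) (l : Fin n)
    {f : Conf n i → V} (hf : f ∈ reflection ρ i) (x : Conf n i) :
    ∑ b : DEdge I, sgn k b • edgeOp ρ i l b (edgeOp ρ i l (rev b) f) x
      = reflectParam i lam (base x l) • f x
        + nu • ∑ m with m ≠ l ∧ base x m = base x l, permOp ρ i (Equiv.swap l m) f x := by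
  by_cases hx : ∃ m, x m = Sum.inl i
  · rw [hf.2.1 x hx, Finset.sum_eq_zero, Finset.sum_eq_zero]
    · simp
    · exact fun m _ => (permOp_mem _ hf).2.1 x hx
    · intro b _
      rw [(edgeOp_mem hi l b (edgeOp_mem hi l (rev b) hf)).2.1 x hx, smul_zero]
  · push Not at hx
    rcases hl : x l with j0 | r0
    · have hj0 : j0 ≠ i := fun h => hx l (by rw [hl, h])
      have hbl : base x l = j0 := by simp [base, hl]
      have hsl : src x l = j0 := by simp [src, hl]
      have key : ∀ b : DEdge I, sgn k b • edgeOp ρ i l b (edgeOp ρ i l (rev b) f) x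
          = sgn k b • ρ (edge lam nu l b) (ρ (edge lam nu l (rev b)) (f x))
            + ((if head b = j0 ∧ tail b = i then lam i else 0) • f x
              - nu • ∑ m with m ≠ l, if head b = j0 ∧ tail b = i
                  ∧ Sum.elim (fun _ => False) (fun r : REdge i => r.1 = rev b) (x m)
                then ρ (perm lam nu (Equiv.swap l m)) (f x) else 0) := by
        intro b
        by_cases hb : head b = j0
        · by_cases hb' : tail b = i
          · obtain ⟨r, rfl⟩ : ∃ r : REdge i, b = rev r.1 :=
              ⟨⟨rev b, (head_rev b).trans hb'⟩, (rev_rev b).symm⟩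
            rw [head_rev] at hb
            rw [edgeOp_rev, rev_rev, edgeOp_head hi, sgn_rev, LinearMap.smul_apply,
              Pi.smul_apply, smul_smul, neg_mul, sgn_mul_self, tauUp_apply, hl, if_pos (by rw [hb]),
              thetaOp_apply]
            have hu : Function.update (Function.update x l (Sum.inr r)) l (Sum.inl (tail r.1))
                = x := by
              rw [Function.update_idem, hb, ← hl, Function.update_eq_self]
            have t1 : tauDown k V r l f (Function.update x l (Sum.inr r)) = f x := by
              rw [tauDown_apply, Function.update_self, if_pos rfl, hu]
            have t2 : muOp ρ i l (piOp ρ i l (tauDown k V r l f)) (Function.update x l (Sum.inr r))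
                = sgn k r.1 • ρ (edge lam nu l (rev r.1)) (ρ (edge lam nu l r.1) (f x)) := by
              rw [muOp_apply_inr ρ l _ _ (r := r) (by simp), piOp_apply, Function.update_self,
                if_pos rfl, Finset.sum_eq_single r]
              · rw [Function.update_idem, Function.update_idem, t1]
              · intro r' _ hr'
                rw [tauDown_apply, if_neg, map_zero]
                rw [Function.update_self]
                exact fun h => hr' (Sum.inr.inj h)
              · simp
            have t3 : swapSum ρ i l (tauDown k V r l f) (Function.update x l (Sum.inr r))
                = ∑ m with m ≠ l, if head (rev r.1) = j0 ∧ tail (rev r.1) = i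
                  ∧ Sum.elim (fun _ => False) (fun r' : REdge i => r'.1 = r.1) (x m)
                then ρ (perm lam nu (Equiv.swap l m)) (f x) else 0 := by
              rw [swapSum_apply, Finset.sum_filter, Finset.sum_filter]
              refine Finset.sum_congr rfl fun m _ => ?_
              by_cases hm : m = l
              · simp [hm]
              · rw [if_pos hm, head_rev, Function.update_of_ne hm, Function.update_self]
                rw [permOp_apply, tauDown_apply, permute_inv_apply, Equiv.swap_apply_right,
                  Function.update_of_ne hm]
                rcases hxm : x m with s | r'
                · simp
                · by_cases hr : r' = r
                  · subst hr
                    rw [if_pos (by simp [hm]), if_pos rfl, if_pos ⟨hb, hb', by simp⟩,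
                      Equiv.swap_comm m l]
                    congr 2
                    ext q
                    by_cases hq : q = l
                    · subst hq; simp [hl, hb]
                    · rw [Function.update_of_ne hq, permute_inv_apply]
                      by_cases hq' : q = m
                      · subst hq'; simp [hxm]
                      · rw [Equiv.swap_apply_of_ne_of_ne hq hq', Function.update_of_ne hq]
                  · have h1 : ¬ ((Sum.inr r' : I ⊕ REdge i) = Sum.inr r) :=
                      fun h => hr (Sum.inr.inj h)
                    have h2 : ¬ (r'.1 = r.1) := fun h => hr (Subtype.ext h)
                    rw [if_neg h1, map_zero, ite_self, if_neg (fun h => h2 h.2.2)]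
            simp only [Pi.add_apply, Pi.neg_apply, Pi.smul_apply]
            rw [t1, t2, t3, if_pos ⟨(head_rev r.1).trans hb, hb'⟩]
            module
          · have hb2 : head b ≠ i := hb ▸ hj0
            rw [edgeOp_slide l b hb' hb2, edgeOp_slide l (rev b) (by rwa [tail_rev])
              (by rwa [head_rev]), slideOp_apply, slideOp_apply, Function.update_idem, head_rev,
              tail_rev, Function.update_self, hb, if_pos hl, if_pos rfl, ← hl,
              Function.update_eq_self]
            simp [hb']
        · rw [rho_edge_zero ρ (hf.1 x) (by rw [hsl, tail_rev]; exact fun h => hb h.symm)]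
          have e0 : ∀ h, edgeOp ρ i l b h x = 0 := by
            intro h
            unfold edgeOp
            split_ifs with h1 h2
            · rw [LinearMap.smul_apply, Pi.smul_apply, tauUp_apply, if_neg, smul_zero]
              rw [hl, tail_rev]
              exact fun h => hb (Sum.inl.inj h).symm
            · rw [thetaOp_apply]
              have t1 : tauDown k V ⟨b, h2⟩ l h x = 0 := by
                rw [tauDown_apply, if_neg]; rw [hl]; exact fun h => by cases h
              have t2 : ∀ h, muOp ρ i l h x = 0 := fun h => muOp_apply_inl ρ l h x hl
              have t3 : ∀ h, swapSum ρ i l h x = 0 := by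
                intro h
                rw [swapSum_apply, Finset.filter_false_of_mem, Finset.sum_empty]
                simp [hl]
              simp [t1, t2, t3]
            · rw [slideOp_apply, if_neg]
              rw [hl]
              exact fun h => hb (Sum.inl.inj h).symm
          simp [e0, hb]
      rw [Finset.sum_congr rfl fun b _ => key b, Finset.sum_add_distrib, rho_relI ρ l _ (hf.1 x),
        Finset.sum_sub_distrib, ← Finset.sum_smul, ← Finset.smul_sum, hsl, hbl,
        reflectParam_ne j0 hj0, Finset.sum_comm]
      have hsum : ∀ m ∈ Finset.univ.filter (fun m => m ≠ l),
          (∑ b : DEdge I, if head b = j0 ∧ tail b = i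
              ∧ Sum.elim (fun _ => False) (fun r : REdge i => r.1 = rev b) (x m)
            then ρ (perm lam nu (Equiv.swap l m)) (f x) else 0)
          = (if src x m = j0 then ρ (perm lam nu (Equiv.swap l m)) (f x) else 0)
            - (if base x m = j0 then permOp ρ i (Equiv.swap l m) f x else 0) := by
        intro m hm
        have hm := (Finset.mem_filter.1 hm).2
        rcases hxm : x m with s | r
        · have e1 : src x m = s := by simp [src, hxm]
          have e2 : base x m = s := by simp [base, hxm]
          rw [e1, e2]
          by_cases hs : s = j0
          · rw [if_pos hs, if_pos hs, permOp_apply, permute_swap x (Ne.symm hm), hxm, hl, hs, ← hl,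
              Function.update_eq_self]
            rw [show (x l) = x m by rw [hl, hxm, hs], Function.update_eq_self]
            simp [hxm]
          · simp [hs]
        · have e1 : src x m = tail r.1 := by simp [src, hxm]
          have e2 : base x m = i := by simp [base, hxm]
          rw [e1, e2, if_neg hj0.symm, sub_zero, Finset.sum_eq_single (rev r.1)]
          · simp [head_rev, tail_rev, r.2, rev_rev]
          · intro b _ hb
            rw [if_neg]
            rintro ⟨_, _, h⟩
            simp only [Sum.elim_inr] at h
            exact hb (by rw [h, rev_rev])
          · simp
      rw [Finset.sum_congr rfl hsum, Finset.sum_sub_distrib]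
      simp only [← Finset.sum_filter, Finset.filter_filter]
      module
    · have hbl : base x l = i := by simp [base, hl]
      have key : ∀ b : DEdge I, head b ≠ i →
          sgn k b • edgeOp ρ i l b (edgeOp ρ i l (rev b) f) x = 0 := by
        intro b hb
        unfold edgeOp
        split_ifs <;> simp [tauUp_apply, slideOp_apply, hl]
      rw [← sum_REdge (i := i) _ key]
      have key2 : ∀ r : REdge i, sgn k r.1 • edgeOp ρ i l r.1 (edgeOp ρ i l (rev r.1) f) x
          = thetaOp ρ r l (tauUp k V r l f) x := by
        intro r
        rw [edgeOp_rev, edgeOp_head hi, LinearMap.smul_apply, map_smul, Pi.smul_apply, smul_smul,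
          sgn_mul_self, one_smul]
      rw [Finset.sum_congr rfl fun r _ => key2 r, ← Finset.sum_apply]
      simp only [thetaOp_apply, Finset.sum_add_distrib, Finset.sum_neg_distrib, ← Finset.smul_sum,
        ← map_sum]
      set S : Conf n i → V := ∑ r : REdge i, tauDown k V r l (tauUp k V r l f) with hS
      have hSx : ∀ y, S y = if (y l).isRight then f y else 0 := by
        intro y
        rw [hS, Finset.sum_apply]
        rcases hy : y l with s | r
        · simp [tauDown_apply, hy]
        · rw [Finset.sum_eq_single r]
          · rw [tauDown_apply, if_pos hy, tauUp_apply, Function.update_self, if_pos rfl,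
              Function.update_idem, ← hy, Function.update_eq_self]
            simp [hy]
          · intro r' _ hr'
            rw [tauDown_apply, if_neg]
            rw [hy]; exact fun h => hr' (Sum.inr.inj h).symm
          · simp
      have hpi : piOp ρ i l S = 0 := by
        rw [← hf.2.2 l]
        ext y
        simp [piOp_apply, hSx]
      rw [hpi, map_zero, add_zero]
      simp only [Pi.add_apply, Pi.neg_apply, Pi.smul_apply]
      rw [hSx, hl, hbl, reflectParam_self hi, swapSum_apply, neg_smul]
      simp only [Sum.isRight_inr, if_true]
      congr 2
      refine Finset.sum_congr ?_ fun m hm => ?_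
      · ext m
        simp only [Finset.mem_filter, Finset.mem_univ, true_and, hl, Sum.isRight_inr, and_true]
        refine and_congr_right fun _ => ?_
        rcases hxm : x m with s | r
        · simp only [base, hxm]
          simp only [Sum.isRight_inl, Bool.false_eq_true, Sum.elim_inl, id, false_iff]
          exact fun h => hx m (by rw [hxm, h])
        · simp [base, hxm]
      · simp only [Finset.mem_filter, Finset.mem_univ, true_and] at hm
        rw [Equiv.swap_comm m l, permOp_apply, permOp_apply, hSx, permute_inv_apply,
          Equiv.swap_apply_left]
        have : (x m).isRight := by
          rcases hxm : x m with s | r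
          · have : s = i := by
              have := hm.2
              simpa [base, hxm] using this
            exact absurd (by rw [hxm, this]) (hx m)
          · rfl
        rw [if_pos this]

end Final

section Functor

variable (ρ : Alg n lam nu →ₐ[k] Module.End k V) {i : I}

lemma permOp_tauDown (σ : Equiv.Perm (Fin n)) (r : REdge i) (l : Fin n) (f : Conf n i → V) :
    permOp ρ i σ (tauDown k V r l f) = tauDown k V r (σ l) (permOp ρ i σ f) := by
  ext x
  rw [permOp_apply, tauDown_apply, tauDown_apply, permOp_apply, permute_inv_apply, permute_update]
  split_ifs <;> simp

lemma permOp_tauUp (σ : Equiv.Perm (Fin n)) (r : REdge i) (l : Fin n) (f : Conf n i → V) :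
    permOp ρ i σ (tauUp k V r l f) = tauUp k V r (σ l) (permOp ρ i σ f) := by
  ext x
  rw [permOp_apply, tauUp_apply, tauUp_apply, permOp_apply, permute_inv_apply, permute_update]
  split_ifs <;> simp

lemma permOp_slideOp (σ : Equiv.Perm (Fin n)) (a : DEdge I) (l : Fin n) (f : Conf n i → V) :
    permOp ρ i σ (slideOp ρ i a l f) = slideOp ρ i a (σ l) (permOp ρ i σ f) := by
  ext x
  rw [permOp_apply, slideOp_apply, slideOp_apply, permOp_apply, permute_inv_apply, permute_update]
  split_ifs
  · rw [rho_perm_edge]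
  · simp

lemma permOp_swapSum (σ : Equiv.Perm (Fin n)) (l : Fin n) (f : Conf n i → V) :
    permOp ρ i σ (swapSum ρ i l f) = swapSum ρ i (σ l) (permOp ρ i σ f) := by
  ext x
  rw [permOp_apply, swapSum_apply, swapSum_apply, map_sum]
  refine Finset.sum_equiv σ (fun m => ?_) fun m _ => ?_
  · rw [Finset.mem_filter, Finset.mem_filter]
    simp [permute_inv_apply]
  · rw [← permOp_mul, ← Equiv.mul_swap_eq_swap_mul, permOp_mul]
    rfl

lemma permOp_edgeOp (σ : Equiv.Perm (Fin n)) (l : Fin n) (a : DEdge I) (f : Conf n i → V) :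
    permOp ρ i σ (edgeOp ρ i l a f) = edgeOp ρ i (σ l) a (permOp ρ i σ f) := by
  unfold edgeOp
  split_ifs
  · simp only [LinearMap.smul_apply, map_smul, permOp_tauUp]
  · simp only [thetaOp_apply, map_add, map_neg, map_smul, permOp_tauDown, permOp_muOp, permOp_piOp,
      permOp_swapSum]
  · rw [permOp_slideOp]

lemma noLoop (hi : IsEmpty (i ⟶ i)) : ∀ a : DEdge I, head a = i → tail a ≠ i := by
  rintro (⟨s, t, e⟩ | ⟨s, t, e⟩) h h' <;> simp only [head, tail] at h h' <;> subst h <;>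
    subst h' <;> exact hi.false e

/-- The operators on `F_i(V)` assigned to the generators of `𝓐_{n, r_i λ, ν}`. -/
def genOp (hi : IsEmpty (i ⟶ i)) : Gen I n → Module.End k (reflection ρ i)
  | Gen.vtx j => (vtxOp k V i j).restrict fun _ hf => vtxOp_mem j hf
  | Gen.edge l a => (edgeOp ρ i l a).restrict fun _ hf => edgeOp_mem (noLoop hi) l a hf
  | Gen.perm σ => (permOp ρ i σ).restrict fun _ hf => permOp_mem σ hf

lemma vtxOp_vtxOp_ne {j j' : Fin n → I} (h : j ≠ j') (f : Conf n i → V) :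
    vtxOp k V i j (vtxOp k V i j' f) = 0 := by
  ext x
  rw [vtxOp_apply]
  split_ifs with h1
  · rw [vtxOp_apply, if_neg (by rw [h1]; exact h)]; rfl
  · rfl

lemma vtxOp_of_supp {j : Fin n → I} {f : Conf n i → V} (h : ∀ x, base x ≠ j → f x = 0) :
    vtxOp k V i j f = f := by
  ext x
  rw [vtxOp_apply]
  split_ifs with h1
  · rfl
  · exact (h x h1).symm

lemma edgeOp_support (l : Fin n) (a : DEdge I)
    {f : Conf n i → V} {x : Conf n i}
    (h : ∀ y : Conf n i, base y l = tail a → base x = Function.update (base y) l (head a) →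
      f y = 0) : edgeOp ρ i l a f x = 0 := by
  have hup : ∀ (z : Conf n i) (s : I ⊕ REdge i), base z = base x → base z l = head a →
      Sum.elim id (fun _ => i) s = tail a → f (Function.update z l s) = 0 := by
    intro z s hz hz' hs
    refine h _ (by rw [base_update, Function.update_self, hs]) ?_
    rw [base_update, Function.update_idem, ← hz, eq_comm, Function.update_eq_iff]
    exact ⟨hz'.symm, fun _ _ => rfl⟩
  unfold edgeOp
  split_ifs with h1 h2
  · rw [LinearMap.smul_apply, Pi.smul_apply, tauUp_apply]
    split_ifs with hx
    · rw [hup x _ rfl (by simp [base, hx, tail_rev]) (by simp [h1]), smul_zero]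
    · simp
  · have hd : ∀ z : Conf n i, base z = base x → tauDown k V ⟨a, h2⟩ l f z = 0 := by
      intro z hz
      rw [tauDown_apply]
      split_ifs with hzl
      · exact hup z _ hz (by simp [base, hzl, h2]) rfl
      · rfl
    rw [thetaOp_apply]
    have t1 := hd x rfl
    have t2 : muOp ρ i l (piOp ρ i l (tauDown k V ⟨a, h2⟩ l f)) x = 0 := by
      rcases hx : x l with s | r
      · exact muOp_apply_inl ρ l _ x hx
      · rw [muOp_apply_inr ρ l _ x hx, piOp_apply, Finset.sum_eq_zero]
        · simp
        · intro r' _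
          rw [Function.update_idem, hd, map_zero]
          rw [base_update, Function.update_eq_iff]
          simp [base, hx]
    have t3 : swapSum ρ i l (tauDown k V ⟨a, h2⟩ l f) x = 0 := by
      rw [swapSum_apply]
      refine Finset.sum_eq_zero fun m hm => ?_
      have hm := (Finset.mem_filter.1 hm).2
      rw [permOp_apply, hd, map_zero]
      obtain ⟨r, hr⟩ := Sum.isRight_iff.1 hm.2.1
      obtain ⟨r', hr'⟩ := Sum.isRight_iff.1 hm.2.2
      rw [permute_swap x hm.1, base_update, base_update, Function.update_comm hm.1,
        Function.update_eq_iff, hr, hr']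
      refine ⟨by simp [base, hr], fun y hy => ?_⟩
      by_cases hyl : y = l
      · subst hyl; simp [base, hr']
      · rw [Function.update_of_ne hyl]
    simp [t1, t2, t3]
  · rw [slideOp_apply]
    split_ifs with hx
    · rw [hup x _ rfl (by simp [base, hx]) rfl, map_zero]
    · rfl

lemma genOp_rel (hi : IsEmpty (i ⟶ i)) {y z : FreeAlgebra k (Gen I n)}
    (h : Rel (reflectParam i lam) nu y z) :
    FreeAlgebra.lift k (genOp ρ hi) y = FreeAlgebra.lift k (genOp ρ hi) z := by
  have hi' := noLoop hi
  have eV : ∀ (j : Fin n → I) (f : reflection ρ i),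
      (FreeAlgebra.lift k (genOp ρ hi) (fV k j) f : Conf n i → V) = vtxOp k V i j f := by
    intro j f; simp [fV, genOp]
  have eE : ∀ (l : Fin n) (a : DEdge I) (f : reflection ρ i),
      (FreeAlgebra.lift k (genOp ρ hi) (fE k l a) f : Conf n i → V) = edgeOp ρ i l a f := by
    intro l a f; simp [fE, genOp]
  have eS : ∀ (σ : Equiv.Perm (Fin n)) (f : reflection ρ i),
      (FreeAlgebra.lift k (genOp ρ hi) (fS k σ) f : Conf n i → V) = permOp ρ i σ f := by
    intro σ f; simp [fS, genOp]
  refine LinearMap.ext fun f => Subtype.ext ?_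
  have vv : ∀ (j : Fin n → I) (g : Conf n i → V) x, base x ≠ j → vtxOp k V i j g x = 0 :=
    fun j g x hx => by rw [vtxOp_apply, if_neg hx]
  cases h with
  | vtx_mul_self j =>
    simp only [map_mul, Module.End.mul_apply, eV]
    exact vtxOp_of_supp (vv j _)
  | vtx_mul_ne j j' h =>
    simp only [map_mul, Module.End.mul_apply, eV, map_zero]
    exact vtxOp_vtxOp_ne h _
  | sum_vtx =>
    simp only [map_sum, map_one, LinearMap.sum_apply, Module.End.one_apply,
      AddSubmonoidClass.coe_finsetSum, eV]
    ext x
    simp [Finset.sum_apply, vtxOp_apply]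
  | edge_vtx l a j h =>
    simp only [map_mul, Module.End.mul_apply, eV, eE]
    refine (vtxOp_of_supp fun x hx => edgeOp_support ρ l a fun y _ hy => vv j _ y ?_).symm
    rintro rfl
    exact hx hy
  | edge_vtx_ne l a j h =>
    simp only [map_mul, Module.End.mul_apply, eV, eE, map_zero]
    ext x
    refine edgeOp_support ρ l a fun y hy _ => vv j _ y ?_
    rintro rfl
    exact h hy
  | perm_one =>
    simp only [map_one, Module.End.one_apply, eS]
    ext x
    rw [permOp_apply, perm_one, map_one]
    rfl
  | perm_mul σ τ =>
    simp only [map_mul, Module.End.mul_apply, eS, permOp_mul]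
  | perm_vtx σ j =>
    simp only [map_mul, Module.End.mul_apply, eS, eV]
    ext x
    rw [permOp_apply, vtxOp_apply, vtxOp_apply, permOp_apply]
    have : base (permute σ⁻¹ x) = j ↔ base x = permute σ j := by
      rw [base_permute]
      constructor
      · rintro rfl; rw [permute_permute_inv]
      · intro h; rw [h]; ext m; simp [permute, Equiv.Perm.inv_def]
    simp only [this]
    split_ifs <;> simp
  | perm_edge σ l a =>
    simp only [map_mul, Module.End.mul_apply, eS, eE]
    exact permOp_edgeOp ρ σ l a _
  | relI l j =>
    have e1 : ∀ a : Quiver.Total I, ∀ g : reflection ρ i,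
        ((FreeAlgebra.lift k (genOp ρ hi) (fE k l (Sum.inl a) * fE k l (Sum.inr a)
            - fE k l (Sum.inr a) * fE k l (Sum.inl a)) g : reflection ρ i) : Conf n i → V)
        = edgeOp ρ i l (Sum.inl a) (edgeOp ρ i l (Sum.inr a) g)
          - edgeOp ρ i l (Sum.inr a) (edgeOp ρ i l (Sum.inl a) g) := by
      intro a g
      simp only [map_sub, map_mul, LinearMap.sub_apply, Module.End.mul_apply,
        AddSubgroupClass.coe_sub, eE]
    simp only [map_mul, map_sum, Module.End.mul_apply, map_smul, LinearMap.smul_apply,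
      LinearMap.sum_apply, AddSubmonoidClass.coe_finsetSum, Submodule.coe_smul]
    rw [map_sub, map_sum, LinearMap.sub_apply, LinearMap.sum_apply, AlgHom.commutes,
      AddSubgroupClass.coe_sub, AddSubmonoidClass.coe_finsetSum]
    simp only [e1, eS, eV, Module.algebraMap_end_apply, Submodule.coe_smul]
    have hg : vtxOp k V i j f ∈ reflection ρ i := vtxOp_mem j f.2
    ext x
    have hrel := edgeOp_relI hi' l hg x
    simp only [Fintype.sum_sum_type, sgn, rev, one_smul, neg_smul, Finset.sum_neg_distrib] at hrel
    simp only [Pi.sub_apply, Finset.sum_apply, Pi.smul_apply, Finset.sum_sub_distrib]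
    rw [sub_eq_add_neg (∑ a, _) (∑ a, _), hrel]
    by_cases hx : base x = j
    · subst hx; simp
    · rw [vv j _ x hx, smul_zero, smul_zero, zero_add, sub_zero, Finset.sum_eq_zero,
        Finset.sum_eq_zero]
      · intro m hm
        have hm := (Finset.mem_filter.1 hm).2
        rw [permOp_apply, vv, map_zero]
        rintro rfl
        apply hx
        have h2 := hm.2
        simp only [base, permute_inv_apply, Equiv.swap_apply_left, Equiv.swap_apply_right] at h2
        ext q
        by_cases h3 : q = l
        · subst h3; simp only [base, permute_inv_apply, Equiv.swap_apply_left]; exact h2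
        · by_cases h4 : q = m
          · subst h4; simp only [base, permute_inv_apply, Equiv.swap_apply_right]; exact h2.symm
          · simp only [base, permute_inv_apply, Equiv.swap_apply_of_ne_of_ne h3 h4]
      · intro m hm
        have hm := (Finset.mem_filter.1 hm).2
        rw [permOp_apply, vv, map_zero]
        rintro rfl
        apply hx
        have h2 := hm.2
        simp only [base] at h2
        ext q
        by_cases h3 : q = l
        · subst h3; simp only [base, permute_inv_apply, Equiv.swap_apply_left]; exact h2.symm
        · by_cases h4 : q = m
          · subst h4; simp only [base, permute_inv_apply, Equiv.swap_apply_right]; exact h2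
          · simp only [base, permute_inv_apply, Equiv.swap_apply_of_ne_of_ne h3 h4]
  | relII l m a b j hlm ha hb =>
    have hg : vtxOp k V i j f ∈ reflection ρ i := vtxOp_mem j f.2
    have es : ∀ (l : Fin n) (a : DEdge I), j l = tail a →
        vtxOp k V i (move l a j) (edgeOp ρ i l a (vtxOp k V i j f))
          = edgeOp ρ i l a (vtxOp k V i j f) := by
      intro l a _
      refine vtxOp_of_supp fun x hx => edgeOp_support ρ l a fun y _ hy => vv j _ y ?_
      rintro rfl
      exact hx hy
    simp only [map_sub, map_mul, map_smul, LinearMap.sub_apply, LinearMap.smul_apply,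
      Module.End.mul_apply, AddSubgroupClass.coe_sub, Submodule.coe_smul, eE, eV, eS]
    rw [es m b hb, es l a ha, sub_eq_iff_eq_add']
    refine edgeOp_edgeOp hi' a b hlm hg fun x hx => vv j _ x ?_
    rintro rfl
    exact hx ⟨ha, hb⟩

/-- The action of `𝓐_{n, r_i λ, ν}` on `F_i(V)`: the idempotents act by the projections, the edges
by the operators `a'_ℓ`, and the permutations by permuting the components. -/
def reflRep (hi : IsEmpty (i ⟶ i)) :
    Alg n (reflectParam i lam) nu →ₐ[k] Module.End k (reflection ρ i) :=
  RingQuot.liftAlgHom k ⟨FreeAlgebra.lift k (genOp ρ hi), fun _ _ h => genOp_rel ρ hi h⟩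

lemma reflRep_mkA (hi : IsEmpty (i ⟶ i)) (y : FreeAlgebra k (Gen I n)) :
    reflRep ρ hi (mkA (reflectParam i lam) nu y) = FreeAlgebra.lift k (genOp ρ hi) y :=
  RingQuot.liftAlgHom_mkAlgHom_apply _ _ _ _

/-- The underlying `k`-module of an `𝓐_{n,λ,ν}`-module. -/
@[reducible] def kModule (M : ModuleCat.{w} (Alg n lam nu)) : Module k M :=
  Module.restrictScalars k (Alg n lam nu) M

attribute [local instance] kModule

/-- The representation of `𝓐_{n,λ,ν}` given by a module. -/
def repOf (M : ModuleCat.{w} (Alg n lam nu)) : Alg n lam nu →ₐ[k] Module.End k M :=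
  haveI : IsScalarTower k (Alg n lam nu) M := IsScalarTower.restrictScalars k (Alg n lam nu) M
  Algebra.lsmul k k M

lemma repOf_apply (M : ModuleCat.{w} (Alg n lam nu)) (a : Alg n lam nu) (v : M) :
    repOf M a v = a • v := rfl

/-- The module `F_i(V)`. -/
def ReflMod (hi : IsEmpty (i ⟶ i)) (M : ModuleCat.{w} (Alg n lam nu)) : Type max u v w :=
  have := hi
  reflection (repOf M) i

instance (hi : IsEmpty (i ⟶ i)) (M : ModuleCat.{w} (Alg n lam nu)) :
    AddCommGroup (ReflMod hi M) :=
  inferInstanceAs (AddCommGroup (reflection (repOf M) i))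

instance (hi : IsEmpty (i ⟶ i)) (M : ModuleCat.{w} (Alg n lam nu)) :
    Module (Alg n (reflectParam i lam) nu) (ReflMod hi M) :=
  Module.compHom (reflection (repOf M) i) (reflRep (repOf M) hi).toRingHom

lemma ReflMod.smul_def (hi : IsEmpty (i ⟶ i)) (M : ModuleCat.{w} (Alg n lam nu))
    (a : Alg n (reflectParam i lam) nu) (f : reflection (repOf M) i) :
    (show ReflMod hi M from a • (show ReflMod hi M from f)) = reflRep (repOf M) hi a f := rfl

/-- A homomorphism of `𝓐_{n,λ,ν}`-modules is applied to each component. -/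
def compOp {M N : ModuleCat.{w} (Alg n lam nu)} (i : I) (g : M →ₗ[Alg n lam nu] N) :
    (Conf n i → M) →ₗ[k] (Conf n i → N) where
  toFun f x := g (f x)
  map_add' _ _ := by ext; simp
  map_smul' c f := by
    ext x
    exact map_smul g (algebraMap k (Alg n lam nu) c) (f x)

lemma map_repOf {M N : ModuleCat.{w} (Alg n lam nu)} (g : M →ₗ[Alg n lam nu] N)
    (a : Alg n lam nu) (v : M) : g (repOf M a v) = repOf N a (g v) := map_smul g a v

lemma map_kSmul {M N : ModuleCat.{w} (Alg n lam nu)} (g : M →ₗ[Alg n lam nu] N)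
    (c : k) (v : M) : g (c • v) = c • g v := map_smul g (algebraMap k (Alg n lam nu) c) v

section Comp

variable {M N : ModuleCat.{w} (Alg n lam nu)} (g : M →ₗ[Alg n lam nu] N)

lemma compOp_apply (f : Conf n i → M) (x : Conf n i) : compOp i g f x = g (f x) := rfl

lemma compOp_piOp (p : Fin n) (f : Conf n i → M) :
    compOp i g (piOp (repOf M) i p f) = piOp (repOf N) i p (compOp i g f) := by
  ext x
  rw [compOp_apply, piOp_apply, piOp_apply]
  split_ifs <;> simp [map_repOf, compOp_apply]

lemma compOp_muOp (p : Fin n) (f : Conf n i → M) :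
    compOp i g (muOp (repOf M) i p f) = muOp (repOf N) i p (compOp i g f) := by
  ext x
  rcases h : x p with s | r
  · rw [compOp_apply, muOp_apply_inl _ p _ x h, muOp_apply_inl _ p _ x h, map_zero]
  · rw [compOp_apply, muOp_apply_inr _ p _ x h, muOp_apply_inr _ p _ x h, map_kSmul, map_repOf]
    rfl

lemma compOp_permOp (σ : Equiv.Perm (Fin n)) (f : Conf n i → M) :
    compOp i g (permOp (repOf M) i σ f) = permOp (repOf N) i σ (compOp i g f) := by
  ext x
  rw [compOp_apply, permOp_apply, permOp_apply, map_repOf]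
  rfl

lemma compOp_vtxOp (j : Fin n → I) (f : Conf n i → M) :
    compOp i g (vtxOp k M i j f) = vtxOp k N i j (compOp i g f) := by
  ext x
  rw [compOp_apply, vtxOp_apply, vtxOp_apply]
  split_ifs <;> simp [compOp_apply]

lemma compOp_edgeOp (l : Fin n) (a : DEdge I) (f : Conf n i → M) :
    compOp i g (edgeOp (repOf M) i l a f) = edgeOp (repOf N) i l a (compOp i g f) := by
  have hd : ∀ r : REdge i, compOp i g (tauDown k M r l f) = tauDown k N r l (compOp i g f) := by
    intro r
    ext x
    rw [compOp_apply, tauDown_apply, tauDown_apply]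
    split_ifs <;> simp [compOp_apply]
  have hs : ∀ f, compOp i g (swapSum (repOf M) i l f) = swapSum (repOf N) i l (compOp i g f) := by
    intro f
    ext x
    rw [compOp_apply, swapSum_apply, swapSum_apply, map_sum]
    exact Finset.sum_congr rfl fun m _ => by rw [← compOp_permOp]; rfl
  unfold edgeOp
  split_ifs
  · rw [LinearMap.smul_apply, LinearMap.smul_apply, map_smul]
    congr 1
    ext x
    rw [compOp_apply, tauUp_apply, tauUp_apply]
    split_ifs <;> simp [compOp_apply]
  · rw [thetaOp_apply, thetaOp_apply, map_add, map_add, map_neg, map_smul, map_smul, compOp_muOp,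
      compOp_piOp, hs, hd]
  · ext x
    rw [compOp_apply, slideOp_apply, slideOp_apply]
    split_ifs
    · rw [map_repOf]; rfl
    · simp

lemma compOp_mem {f : Conf n i → M} (hf : f ∈ reflection (repOf M) i) :
    compOp i g f ∈ reflection (repOf N) i := by
  obtain ⟨h1, h2, h3⟩ := hf
  refine ⟨fun x => ?_, fun x hx => ?_, fun p => ?_⟩
  · rw [compOp_apply, ← map_repOf, h1 x]
  · rw [compOp_apply, h2 x hx, map_zero]
  · rw [← compOp_piOp, h3, map_zero]

/-- The restriction of `compOp` to the modules `F_i(V)`. -/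
def reflMapK (i : I) (g : M →ₗ[Alg n lam nu] N) :
    reflection (repOf M) i →ₗ[k] reflection (repOf N) i :=
  (compOp i g).restrict fun _ hf => compOp_mem g hf

lemma reflMapK_reflRep (hi : IsEmpty (i ⟶ i)) (a : Alg n (reflectParam i lam) nu)
    (f : reflection (repOf M) i) :
    reflMapK i g (reflRep (repOf M) hi a f) = reflRep (repOf N) hi a (reflMapK i g f) := by
  obtain ⟨y, rfl⟩ := mkA_surjective _ _ a
  rw [reflRep_mkA, reflRep_mkA]
  induction y using FreeAlgebra.induction generalizing f with
  | grade0 c => simp [AlgHom.commutes]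
  | grade1 s =>
    rw [FreeAlgebra.lift_ι_apply, FreeAlgebra.lift_ι_apply]
    refine Subtype.ext ?_
    cases s with
    | vtx j => exact compOp_vtxOp g j f.1
    | edge l a => exact compOp_edgeOp g l a f.1
    | perm σ => exact compOp_permOp g σ f.1
  | mul y z hy hz => rw [map_mul, map_mul, Module.End.mul_apply, hy, hz, Module.End.mul_apply]
  | add y z hy hz => rw [map_add, map_add, LinearMap.add_apply, map_add, hy, hz,
      LinearMap.add_apply]

end Comp

/-- The homomorphism `F_i(g) : F_i(V) → F_i(W)`. -/
def reflMap (hi : IsEmpty (i ⟶ i)) {M N : ModuleCat.{w} (Alg n lam nu)}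
    (g : M →ₗ[Alg n lam nu] N) :
    ReflMod hi M →ₗ[Alg n (reflectParam i lam) nu] ReflMod hi N where
  toFun f := reflMapK i g f
  map_add' f f' := map_add (reflMapK i g) f f'
  map_smul' a f := reflMapK_reflRep g hi a f

end Functor

/-- The reflection functor `F_i : 𝓐_{n,λ,ν}-mod ⥤ 𝓐_{n,r_i λ,ν}-mod` at a vertex `i` without
edge-loops. The universe of the modules is large enough to contain the index sets. -/
def reflectionFunctor (n : ℕ) (lam : I → k) (nu : k) (i : I) (hi : IsEmpty (i ⟶ i)) :
    ModuleCat.{max u v w} (Alg n lam nu) ⥤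
      ModuleCat.{max u v w} (Alg n (reflectParam i lam) nu) where
  obj M := ModuleCat.of _ (ReflMod hi M)
  map g := ModuleCat.ofHom (reflMap hi g.hom)
  map_id _ := rfl
  map_comp _ _ := rfl

end Reflection

/-- The set `Λ_i` of all `(λ, ν)` such that `λ_i ± ν ∑_{m=2}^r s_{1m}` are invertible in `k[S_r]`
for all `r ∈ [1, n]`. The symmetric group `S_r`, `r = s + 1`, acts on `Fin (s + 1)`, and the
letter `1` is `0 : Fin (s + 1)`. -/
def genericSet {k : Type uk} [CommRing k] {I : Type u} (n : ℕ) (i : I) : Set ((I → k) × k) :=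
  {p | ∀ s : ℕ, s + 1 ≤ n →
    IsUnit (algebraMap k (MonoidAlgebra k (Equiv.Perm (Fin (s + 1)))) (p.1 i)
      + p.2 • ∑ m : Fin s, MonoidAlgebra.of k (Equiv.Perm (Fin (s + 1))) (Equiv.swap 0 m.succ)) ∧
    IsUnit (algebraMap k (MonoidAlgebra k (Equiv.Perm (Fin (s + 1)))) (p.1 i)
      - p.2 • ∑ m : Fin s, MonoidAlgebra.of k (Equiv.Perm (Fin (s + 1))) (Equiv.swap 0 m.succ))}

end

end WreathReflection

/-! Left exactness is formal: `reflection` is cut out of a product of copies of V, component by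
component, by conditions natural in V. The content is that a surjection g : M → N stays surjective,
that is, that a family f in V'_j for N lifts to a family in V'_j for M.

Some lift e of f in V(j, Δ(j)) always exists, and the obstructions are the families π_p e, which
take values in K = ker g. They are removed one position at a time (`exists_lift_of_finset`). Suppose
π_m e = 0 for m ∈ A, and let q ∈ Δ(j) \ A. Then h = π_q e is K-valued because π_q f = 0, it lives on
V(j, Δ(j) \ {q}), and it is killed by π_m for m ∈ A because the maps π commute, and trivially by
π_q. It suffices to find a K-valued e' in V(j, Δ(j)) with π_q e' = h and π_m e' = 0 for m ∈ A
(`exists_piOp_eq`), and to pass to e - e'.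

Such an e' is sought as the sum of μ_p y over p ∈ A ∪ {q}, where y lies in the sum of the V(j, Δ(j)
\ {p}) and is killed by every π_p with p ∈ A ∪ {q}. On the component that omits b, relation (i)
gives π_b μ_b y = λ_i y, without transpositions, since there b is the only position whose source
vertex is i (`piOp_muOp_self_of_mem_cycles`). For p ≠ b, relation (ii) gives π_b μ_p y = -ν s_{bp} y
(`piOp_muOp_of_mem_cycles`). So on that component π_b e' is (λ_i - ν ∑_{p ≠ b} s_{bp}) y, and this
has to equal h there, which is 0 unless b = q.

The operator depends on b, yet one y serves for all b. Let r = |A| + 1, let S_r permute the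
positions in A ∪ {q} with the letter 1 placed at q, and let y = a h, where a is the inverse of λ_i -
ν ∑ s_{1m} in the group algebra of S_r. Conjugation by g turns the sum of transpositions at b into
the one at g⁻¹(b); and since h lives only on the component omitting q, all these sums agree with the
one at q on the components that are read off (`swaps_groupAct_apply`). The left factor that varies
with b thus becomes a fixed right factor, a (λ_i - ν ∑ s_{1m}) = 1 applies, and the result is h. -/

namespace WreathReflection

noncomputable section

open scoped Classical

/-! ### The symmetric group algebra acting on families, and its sums of transpositions -/

section GroupAlgebraAction

variable {k : Type uk} [CommRing k] {I : Type u} [Quiver.{v} I]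
  [Fintype I] [Fintype (Quiver.Total I)] {n : ℕ} {lam : I → k} {nu : k}
  {V : Type w} [AddCommGroup V] [Module k V]
  (ρ : Alg n lam nu →ₐ[k] Module.End k V) (i : I)

/-- The permutation operators as an action of the symmetric group. -/
def permHom : Equiv.Perm (Fin n) →* Module.End k (Conf n i → V) where
  toFun σ := permOp ρ i σ
  map_one' := by
    refine LinearMap.ext fun f => funext fun x => ?_
    rw [permOp_apply, perm_one, map_one]
    rfl
  map_mul' σ τ := by
    exact LinearMap.ext fun f => permOp_mul ρ σ τ f

variable {s : ℕ} (ι : Fin (s + 1) ↪ Fin n)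

/-- The action of `k[S_{s+1}]` that permutes the positions in the range of `ι`. -/
def groupAct : MonoidAlgebra k (Equiv.Perm (Fin (s + 1))) →ₐ[k] Module.End k (Conf n i → V) :=
  MonoidAlgebra.lift k _ _ ((permHom ρ i).comp (Equiv.Perm.viaEmbeddingHom ι))

lemma groupAct_of (g : Equiv.Perm (Fin (s + 1))) :
    groupAct ρ i ι (MonoidAlgebra.of k _ g) = permOp ρ i (g.viaEmbedding ι) := by
  rw [groupAct, MonoidAlgebra.lift_of]
  rfl

lemma viaEmbedding_swap (a b : Fin (s + 1)) :
    (Equiv.swap a b).viaEmbedding ι = Equiv.swap (ι a) (ι b) := by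
  ext m
  by_cases hm : m ∈ Set.range ι
  · obtain ⟨c, rfl⟩ := hm
    rw [Equiv.Perm.viaEmbedding_apply, ι.injective.swap_apply]
  · rw [Equiv.Perm.viaEmbedding_apply_of_notMem _ _ _ hm, Equiv.swap_apply_of_ne_of_ne]
    · rintro rfl; exact hm ⟨a, rfl⟩
    · rintro rfl; exact hm ⟨b, rfl⟩

variable {i ι}

/-- Stability under the group passes to its linear span. With W = `cycles` it keeps the family a h,
a in the group algebra, among the cycles. -/
lemma groupAct_mem {W : Submodule k (Conf n i → V)}
    (hW : ∀ (g : Equiv.Perm (Fin (s + 1))) (y), y ∈ W → permOp ρ i (g.viaEmbedding ι) y ∈ W)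
    (a : MonoidAlgebra k (Equiv.Perm (Fin (s + 1)))) {y : Conf n i → V} (hy : y ∈ W) :
    groupAct ρ i ι a y ∈ W := by
  induction a using MonoidAlgebra.induction_on with
  | of g => rw [groupAct_of]; exact hW g y hy
  | add a b ha hb => rw [map_add]; exact W.add_mem ha hb
  | smul c a ha => rw [map_smul]; exact W.smul_mem c ha

/-- The sum of the transpositions that move `c`. -/
def swaps (k : Type uk) [CommRing k] {s : ℕ} (c : Fin (s + 1)) :
    MonoidAlgebra k (Equiv.Perm (Fin (s + 1))) :=
  ∑ m with m ≠ c, MonoidAlgebra.of k _ (Equiv.swap c m)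

/-- Matches the element used in the proof with the one whose invertibility `genericSet` prescribes.
-/
lemma swaps_zero : swaps k (0 : Fin (s + 1))
    = ∑ m : Fin s, MonoidAlgebra.of k (Equiv.Perm (Fin (s + 1))) (Equiv.swap 0 m.succ) := by
  rw [swaps, Finset.sum_filter, Fin.sum_univ_succ]
  simp [Fin.succ_ne_zero]

/-- Conjugating the transposition (c m) by g⁻¹ gives (g⁻¹c g⁻¹m), so the summands correspond under m
↦ g⁻¹m. The sums are not central in general, but the group permutes them among themselves. -/
lemma swaps_mul_of (g : Equiv.Perm (Fin (s + 1))) (c : Fin (s + 1)) :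
    swaps k c * MonoidAlgebra.of k _ g = MonoidAlgebra.of k _ g * swaps k (g⁻¹ c) := by
  rw [swaps, swaps, Finset.sum_mul, Finset.mul_sum]
  refine Finset.sum_equiv g⁻¹ (fun m => ?_) fun m _ => ?_
  · simp
  · rw [← map_mul, ← map_mul, Equiv.mul_swap_eq_swap_mul]
    simp

lemma groupAct_swaps (c : Fin (s + 1)) (y : Conf n i → V) (x : Conf n i) :
    groupAct ρ i ι (swaps k c) y x
      = ∑ m with m ≠ c, permOp ρ i (Equiv.swap (ι c) (ι m)) y x := by
  simp only [swaps, map_sum, LinearMap.sum_apply, Finset.sum_apply, groupAct_of, viaEmbedding_swap]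

/-- On a family concentrated on the configurations with `D = Δ(j) \ {ι 0}`, all the sums of
transpositions have the same components at the configurations that they share. -/
lemma groupAct_swaps_apply {h : Conf n i → V}
    (hh : ∀ x, h x ≠ 0 → ∀ m, x m = Sum.inl i → m = ι 0)
    (c : Fin (s + 1)) (x : Conf n i) (hx : x (ι c) = Sum.inl i) :
    groupAct ρ i ι (swaps k c) h x = groupAct ρ i ι (swaps k 0) h x := by
  by_cases hc : c = 0
  · rw [hc]
  -- The component at `x` of `σ⁻¹` applied to `h` comes from the configuration that has the vertex
  -- `i` at `σ (ι c)`, where `h` vanishes unless that position is `ι 0`. The inverse is harmless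
  -- below, transpositions being involutions.
  have key : ∀ σ : Equiv.Perm (Fin n), σ (ι c) ≠ ι 0 → permOp ρ i σ⁻¹ h x = 0 := by
    intro σ hσ
    rw [permOp_apply]
    by_contra hne
    refine hσ (hh (permute (σ⁻¹)⁻¹ x) (fun h0 => hne (by rw [h0, map_zero])) _ ?_)
    rw [permute_inv_apply]
    simpa using hx
  -- In each of the two sums only the transposition carrying `ι c` to `ι 0` survives, and it is the
  -- same one: the term m = 0 of the sum at `c` and the term m = c of the sum at `0`.
  rw [groupAct_swaps, groupAct_swaps, Finset.sum_eq_single 0, Finset.sum_eq_single c,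
    Equiv.swap_comm]
  · intro m _ hmc
    rw [← Equiv.swap_inv]
    refine key _ ?_
    rw [Equiv.swap_apply_of_ne_of_ne]
    · simpa using hc
    · simpa using hc
    · simpa using Ne.symm hmc
  · intro h0
    exact absurd (by simpa using hc) h0
  · intro m _ hm0
    rw [← Equiv.swap_inv]
    refine key _ ?_
    rw [Equiv.swap_apply_left]
    simpa using hm0
  · intro h0
    exact absurd (by simpa using Ne.symm hc) h0

/-- For a = g, the sum at c passes g and becomes the sum at g⁻¹c. A component with the vertex i at
position c is read off from one with i at position g⁻¹c, where the sums at g⁻¹c and at 0 agree on h.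
The outcome no longer depends on c: left multiplication by a varying element has become right
multiplication by a fixed one. The general case follows by linearity. -/
lemma swaps_groupAct_apply {h : Conf n i → V}
    (hh : ∀ x, h x ≠ 0 → ∀ m, x m = Sum.inl i → m = ι 0)
    (a : MonoidAlgebra k (Equiv.Perm (Fin (s + 1)))) (c : Fin (s + 1)) (x : Conf n i)
    (hx : x (ι c) = Sum.inl i) :
    groupAct ρ i ι (swaps k c) (groupAct ρ i ι a h) x
      = groupAct ρ i ι (a * swaps k 0) h x := by
  induction a using MonoidAlgebra.induction_on with
  | of g =>
    rw [← Module.End.mul_apply, ← map_mul, swaps_mul_of, map_mul, map_mul, groupAct_of,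
      Module.End.mul_apply, Module.End.mul_apply, permOp_apply, permOp_apply,
      groupAct_swaps_apply ρ hh]
    rw [permute_inv_apply, Equiv.Perm.viaEmbedding_apply]
    simpa using hx
  | add a b ha hb =>
    rw [add_mul, map_add, map_add, LinearMap.add_apply, LinearMap.add_apply, map_add, Pi.add_apply,
      Pi.add_apply, ha, hb]
  | smul r a ha =>
    rw [smul_mul_assoc, map_smul, map_smul, LinearMap.smul_apply, LinearMap.smul_apply, map_smul,
      Pi.smul_apply, Pi.smul_apply, ha]

/-- Right inverses of `λ_i - ν ∑ s_{1m}` in the group algebra give componentwise solutions. -/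
lemma groupAct_inverse_apply {h : Conf n i → V}
    (hh : ∀ x, h x ≠ 0 → ∀ m, x m = Sum.inl i → m = ι 0)
    {a : MonoidAlgebra k (Equiv.Perm (Fin (s + 1)))}
    (ha : a * (algebraMap k _ (lam i) - nu • swaps k 0) = 1) (c : Fin (s + 1)) (x : Conf n i)
    (hx : x (ι c) = Sum.inl i) :
    lam i • groupAct ρ i ι a h x
      - nu • groupAct ρ i ι (swaps k c) (groupAct ρ i ι a h) x = h x := by
  -- It is a left inverse that is needed, since the sum of transpositions ends up to the right of
  -- `a`.
  have h1 := congrArg (fun b => groupAct ρ i ι b h x) ha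
  rw [mul_sub, ← Algebra.commutes, ← Algebra.smul_def, mul_smul_comm] at h1
  rw [swaps_groupAct_apply ρ hh a c x hx]
  simpa using h1

end GroupAlgebraAction

/-! ### Solving π_q f = h on families that omit one position -/

section Lifting

/-- The tuple j is constant on the range of ι and the permutation is the identity off it, so j is a
fixed point. Hence the group permutes the components over j among themselves. -/
lemma permute_viaEmbedding {I : Type u} {i : I} {n s : ℕ} {ι : Fin (s + 1) ↪ Fin n}
    {j : Fin n → I} (hj : ∀ a, j (ι a) = i)
    (g : Equiv.Perm (Fin (s + 1))) {j' : Fin n → I} (h : permute (g.viaEmbedding ι)⁻¹ j' = j) :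
    j' = j := by
  have key : ∀ m, j (g.viaEmbedding ι m) = j m := by
    intro m
    by_cases hm : m ∈ Set.range ι
    · obtain ⟨c, rfl⟩ := hm
      rw [Equiv.Perm.viaEmbedding_apply, hj, hj]
    · rw [Equiv.Perm.viaEmbedding_apply_of_notMem _ _ _ hm]
  ext m
  obtain ⟨m, rfl⟩ := (g.viaEmbedding ι).surjective m
  rw [key, ← h, permute_inv_apply]

variable {k : Type uk} [CommRing k] {I : Type u} [Quiver.{v} I]
  [Fintype I] [Fintype (Quiver.Total I)] {n : ℕ} {lam : I → k} {nu : k}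
  {V : Type w} [AddCommGroup V] [Module k V]
  (ρ : Alg n lam nu →ₐ[k] Module.End k V) {i : I} {s : ℕ} (ι : Fin (s + 1) ↪ Fin n)

/-- The families in `⨁_a V(j, Δ(j) \ {ι a})` with values in `N` that are killed by the maps
`π_{ι b}`. -/
def cycles (N : Submodule k V) (j : Fin n → I) : Submodule k (Conf n i → V) where
  carrier := {y | Graded ρ y ∧ (∀ x, y x ∈ N) ∧
    -- Exactly one position of Δ(j) carries no edge, and it may be any point of the range of `ι`.
    -- Fixing it at `ι 0`, as for the right-hand side h, would not be stable under permutations.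
    (∀ x, y x ≠ 0 → base x = j ∧ ∃ a, ∀ m, x m = Sum.inl i ↔ m = ι a) ∧
    ∀ a, piOp ρ i (ι a) y = 0}
  add_mem' := by
    rintro f g ⟨h1, h2, h3, h4⟩ ⟨h1', h2', h3', h4'⟩
    refine ⟨fun x => ?_, fun x => N.add_mem (h2 x) (h2' x), fun x hx => ?_, fun a => ?_⟩
    · rw [Pi.add_apply, map_add, h1 x, h1' x]
    · by_cases hf : f x = 0
      · exact h3' x fun hg => hx (by rw [Pi.add_apply, hf, hg, add_zero])
      · exact h3 x hf
    · rw [map_add, h4, h4', add_zero]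
  zero_mem' := by
    refine ⟨fun x => ?_, fun x => N.zero_mem, fun x hx => absurd rfl hx, fun a => map_zero _⟩
    rw [Pi.zero_apply, map_zero]
  smul_mem' := by
    rintro c f ⟨h1, h2, h3, h4⟩
    refine ⟨fun x => ?_, fun x => N.smul_mem c (h2 x), fun x hx => h3 x fun hf => hx ?_,
      fun a => ?_⟩
    · rw [Pi.smul_apply, map_smul, h1 x]
    · rw [Pi.smul_apply, hf, smul_zero]
    · rw [map_smul, h4, smul_zero]

variable {ι}

variable {N : Submodule k V} {j : Fin n → I}

/-- A permutation g moves the omitted position ι a to ι (g a) and conjugates π at ι b into π at ι (g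
b), so the conditions over all positions in the range of ι are only permuted. Values stay in N
because N is a submodule for the whole algebra. -/
lemma permOp_mem_cycles (hN : ∀ a, ∀ v ∈ N, ρ a v ∈ N) (hj : ∀ a, j (ι a) = i)
    (g : Equiv.Perm (Fin (s + 1))) {y : Conf n i → V} (hy : y ∈ cycles ρ ι N j) :
    permOp ρ i (g.viaEmbedding ι) y ∈ cycles ρ ι N j := by
  obtain ⟨h1, h2, h3, h4⟩ := hy
  refine ⟨Graded.permOp h1 _, fun x => hN _ _ (h2 _), fun x hx => ?_, fun a => ?_⟩
  · obtain ⟨hb, a, ha⟩ := h3 _ fun h0 => hx (by rw [permOp_apply, h0, map_zero])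
    refine ⟨permute_viaEmbedding hj g hb, g a, fun m => ?_⟩
    obtain ⟨m, rfl⟩ := (g.viaEmbedding ι).surjective m
    rw [← Equiv.Perm.viaEmbedding_apply, EmbeddingLike.apply_eq_iff_eq, ← ha m, permute_inv_apply]
  · obtain ⟨b, rfl⟩ := g.surjective a
    rw [← Equiv.Perm.viaEmbedding_apply, ← permOp_piOp, h4, map_zero]

/-- The transpositions in relation (i) run over the other positions whose source vertex is i. On the
support of y there are none: every other position of Δ(j) carries an edge into i, whose tail is not
i since i has no loops. Only the scalar λ_i remains. -/
lemma piOp_muOp_self_of_mem_cycles (hi : ∀ a : DEdge I, head a = i → tail a ≠ i)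
    {y : Conf n i → V} (hy : y ∈ cycles ρ ι N j) (b : Fin (s + 1)) {x : Conf n i}
    (hx : x (ι b) = Sum.inl i) :
    piOp ρ i (ι b) (muOp ρ i (ι b) y) x = lam i • y x := by
  obtain ⟨h1, h2, h3, h4⟩ := hy
  by_cases hm : ∀ m, m ≠ ι b → src x m ≠ i
  · exact piOp_muOp_self ρ h1 x hx hm
  · push Not at hm
    obtain ⟨m, hmb, hm⟩ := hm
    have hxm : x m = Sum.inl i := by
      by_contra h0
      exact src_ne hi h0 hm
    have hy0 : y x = 0 := by
      by_contra h0
      obtain ⟨-, a, ha⟩ := h3 x h0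
      exact hmb (((ha m).1 hxm).trans ((ha _).1 hx).symm)
    rw [hy0, smul_zero, piOp_apply, if_pos hx]
    refine Finset.sum_eq_zero fun r _ => ?_
    rw [muOp_apply_inr ρ _ _ _ (Function.update_self ..), Function.update_idem, ← hx,
      Function.update_eq_self, hy0]
    simp

/-- Interchanging π at ι b with μ at ι p costs, by relation (ii), the term -ν s_{bp} y. The
interchanged product is zero since y is killed by π at ι b. -/
lemma piOp_muOp_of_mem_cycles (hj : ∀ a, j (ι a) = i) {y : Conf n i → V}
    (hy : y ∈ cycles ρ ι N j) {b p : Fin (s + 1)} (hbp : p ≠ b) {x : Conf n i}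
    (hx : x (ι b) = Sum.inl i) :
    piOp ρ i (ι b) (muOp ρ i (ι p) y) x = - nu • permOp ρ i (Equiv.swap (ι b) (ι p)) y x := by
  obtain ⟨h1, h2, h3, h4⟩ := hy
  rw [piOp_muOp ρ (ι.injective.ne hbp.symm) h1, h4, map_zero, Pi.zero_apply, zero_sub, neg_smul]
  split_ifs with hr
  · rfl
  -- Here the correction term of `piOp_muOp` is absent, so the transposed family has to vanish at
  -- `x`. Otherwise `x` would lie over `j`, the position `ι p` would carry the vertex `i` like `ι
  -- b`, and a component of `y` omitting two positions would be nonzero.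
  · congr 2
    by_contra h0
    obtain ⟨hb, a, ha⟩ := h3 _ fun h => h0 (by rw [permOp_apply, h, map_zero])
    rw [← viaEmbedding_swap] at hb
    have hb' := congrFun (permute_viaEmbedding (j' := base x) hj _ hb) (ι p)
    rw [hj] at hb'
    rcases hp : x (ι p) with t | r
    · have ht : t = i := by simpa [base, hp] using hb'
      have e1 := (ha (ι b)).1 (by rw [permute_inv_apply, Equiv.swap_apply_left, hp, ht])
      have e2 := (ha (ι p)).1 (by rw [permute_inv_apply, Equiv.swap_apply_right, hx])
      exact hbp (ι.injective (e2.trans e1.symm))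
    · exact hr ⟨hx, by simp [hp]⟩

/-- The elements of `V(j, Δ(j) \ {q})` killed by the maps `π_p`, `p ∈ A`, are the images under `π_q`
of elements of `V(j, Δ(j))` that are killed by these maps. -/
lemma exists_piOp_eq (hi : ∀ a : DEdge I, head a = i → tail a ≠ i)
    (hN : ∀ a, ∀ v ∈ N, ρ a v ∈ N) (hj : ∀ a, j (ι a) = i)
    (hu : IsUnit (algebraMap k (MonoidAlgebra k (Equiv.Perm (Fin (s + 1)))) (lam i)
      - nu • swaps k 0))
    {h : Conf n i → V} (hh : h ∈ cycles ρ ι N j)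
    (hs : ∀ x, h x ≠ 0 → x (ι 0) = Sum.inl i) :
    ∃ f : Conf n i → V, Graded ρ f ∧ (∀ x, f x ∈ N) ∧
      (∀ x, f x ≠ 0 → base x = j ∧ ∀ m, x m ≠ Sum.inl i) ∧
      piOp ρ i (ι 0) f = h ∧ ∀ a, a ≠ 0 → piOp ρ i (ι a) f = 0 := by
  obtain ⟨a, -, ha⟩ := isUnit_iff_exists.1 hu
  have hs' : ∀ x, h x ≠ 0 → ∀ m, x m = Sum.inl i → m = ι 0 := fun x hx m hm => by
    obtain ⟨-, c, hc⟩ := hh.2.2.1 x hx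
    rw [(hc m).1 hm, (hc _).1 (hs x hx)]
  -- The solution will be ∑ μ_p y over the positions in the range of `ι`. Applying π at `ι b` to it
  -- gives (λ_i - ν ∑ s_{bp}) y on the component omitting `ι b`, and this `y` makes that equal to
  -- `h` for all `b` at once.
  set y := groupAct ρ i ι a h with hy
  have hyc : y ∈ cycles ρ ι N j :=
    groupAct_mem ρ (fun g y hy => permOp_mem_cycles ρ hN hj g hy) a hh
  have key : ∀ (b : Fin (s + 1)) (x : Conf n i), x (ι b) = Sum.inl i →
      piOp ρ i (ι b) (∑ p, muOp ρ i (ι p) y) x = h x := by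
    intro b x hx
    rw [← groupAct_inverse_apply ρ hs' ha b x hx, map_sum, Finset.sum_apply,
      ← Finset.add_sum_erase _ _ (Finset.mem_univ b),
      piOp_muOp_self_of_mem_cycles ρ hi hyc b hx, groupAct_swaps, sub_eq_add_neg, Finset.smul_sum,
      ← Finset.sum_neg_distrib]
    congr 1
    -- The term p = b has produced λ_i y; each other p produces one summand of -ν times the sum of
    -- transpositions at `b`.
    refine Finset.sum_congr (by ext; simp) fun p hp => ?_
    rw [piOp_muOp_of_mem_cycles ρ hj hyc (by simpa using hp) hx, neg_smul]
  refine ⟨∑ p, muOp ρ i (ι p) y, fun x => ?_, fun x => ?_, fun x hx => ?_, ?_, fun b hb => ?_⟩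
  · rw [Finset.sum_apply, map_sum]
    exact Finset.sum_congr rfl fun p _ => Graded.muOp hyc.1 _ x
  · rw [Finset.sum_apply]
    refine N.sum_mem fun p _ => ?_
    rcases hx : x (ι p) with t | r
    · rw [muOp_apply_inl ρ _ _ _ hx]; exact N.zero_mem
    · rw [muOp_apply_inr ρ _ _ _ hx]; exact N.smul_mem _ (hN _ _ (hyc.2.1 _))
  · rw [Finset.sum_apply] at hx
    obtain ⟨p, -, hp⟩ := Finset.exists_ne_zero_of_sum_ne_zero hx
    rcases hxp : x (ι p) with t | r
    · exact absurd (muOp_apply_inl ρ _ _ _ hxp) hp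
    · rw [muOp_apply_inr ρ _ _ _ hxp] at hp
      obtain ⟨hb, c, hc⟩ := hyc.2.2.1 _ fun h0 => hp (by rw [h0, map_zero, smul_zero])
      -- The position omitted by this component of `y` is `ι p` itself, which μ has just filled;
      -- hence no position is left with the vertex `i`.
      have hpc := (hc (ι p)).1 (Function.update_self ..)
      constructor
      · rw [← hb, base_update, eq_comm, Function.update_eq_self_iff]
        simp [base, hxp]
      · intro m hm
        have hmp : m ≠ ι p := by rintro rfl; simp [hxp] at hm
        exact hmp (((hc m).1 (by rw [Function.update_of_ne hmp, hm])).trans hpc.symm)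
  · ext x
    by_cases hx : x (ι 0) = Sum.inl i
    · exact key 0 x hx
    · rw [piOp_apply, if_neg hx]
      by_contra h0
      exact hx (hs x (Ne.symm h0))
  · ext x
    by_cases hx : x (ι b) = Sum.inl i
    · rw [key b x hx]
      by_contra h0
      exact hb (ι.injective (hs' x h0 _ hx))
    · rw [piOp_apply, if_neg hx]; rfl

end Lifting

/-! ### Lifting along surjections, left exactness, and the conclusion -/

section Exactness

variable {k : Type uk} [CommRing k] {I : Type u} [Quiver.{v} I]
  [Fintype I] [Fintype (Quiver.Total I)] {n : ℕ} {lam : I → k} {nu : k} {i : I}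

attribute [local instance] kModule

variable {M N : ModuleCat.{w} (Alg n lam nu)} (g : M →ₗ[Alg n lam nu] N)

/-- The kernel of a homomorphism as a `k`-submodule. -/
def kerK : Submodule k M where
  carrier := {v | g v = 0}
  add_mem' := by
    intro a b ha hb
    rw [Set.mem_ofPred_eq] at ha hb ⊢
    rw [map_add, ha, hb, add_zero]
  zero_mem' := map_zero g
  smul_mem' c v hv := by
    rw [Set.mem_ofPred_eq] at hv ⊢
    rw [map_kSmul, hv, smul_zero]

/-- Induction on A. The defect π_q e at a new position q has values in the kernel of g and is still
killed by π_m for m ∈ A, so it can be removed by a correction with values in the kernel: the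
correction changes neither the image in N nor the equations already obtained. -/
lemma exists_lift_of_finset (hi : IsEmpty (i ⟶ i)) (hΛ : (lam, nu) ∈ genericSet (k := k) n i)
    (hg : Function.Surjective g) {j : Fin n → I} {f : Conf n i → N}
    (hf : f ∈ reflection (repOf N) i) (hfj : ∀ x, base x ≠ j → f x = 0) (A : Finset (Fin n))
    (hA : ∀ m ∈ A, j m = i) :
    ∃ e : Conf n i → M, Graded (repOf M) e ∧ (∀ x, e x ≠ 0 → base x = j ∧ ∀ m, x m ≠ Sum.inl i) ∧
      compOp i g e = f ∧ ∀ m ∈ A, piOp (repOf M) i m e = 0 := by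
  induction A using Finset.induction_on with
  | empty =>
    choose c hc using hg
    -- Arbitrary set-theoretic preimages, made homogeneous by the idempotents and cut off outside
    -- V(j, Δ(j)). The idempotent does no harm, since it fixes the components of `f`.
    refine ⟨fun x => if base x = j ∧ ∀ m, x m ≠ Sum.inl i then
      repOf M (vtx lam nu (src x)) (c (f x)) else 0, fun x => ?_, fun x hx => ?_, ?_, by simp⟩
    · dsimp only
      split_ifs
      · rw [← Module.End.mul_apply, ← map_mul, vtx_mul_self]
      · exact map_zero _
    · by_contra h0
      exact hx (if_neg h0)
    · ext x
      rw [compOp_apply]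
      split_ifs with h
      · rw [map_repOf, hc, hf.1 x]
      · rw [map_zero]
        by_cases hb : base x = j
        · have h' : ∃ m, x m = Sum.inl i := by
            by_contra h0
            exact h ⟨hb, not_exists.1 h0⟩
          exact (hf.2.1 x h').symm
        · exact (hfj x hb).symm
  | insert q A hq ih =>
    obtain ⟨e, he1, he2, he3, he4⟩ := ih fun m hm => hA m (Finset.mem_insert_of_mem hm)
    -- The new position `q` gets the distinguished letter 0, and the elements of `A` get the others
    -- in any order. This is why invertibility is used for S_r with r = |A| + 1, and thus for
    -- varying r ≤ n.
    let ι : Fin (A.card + 1) ↪ Fin n := ⟨Fin.cons q (A.orderEmbOfFin rfl), by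
      rw [Fin.cons_injective_iff]
      refine ⟨fun ⟨a, ha⟩ => hq ?_, (A.orderEmbOfFin rfl).injective⟩
      rw [← ha]
      exact Finset.orderEmbOfFin_mem ..⟩
    have hι0 : ι 0 = q := rfl
    have hιA : ∀ a, a ≠ 0 → ι a ∈ A := by
      intro a ha
      obtain ⟨b, rfl⟩ := Fin.exists_succ_eq.2 ha
      exact Finset.orderEmbOfFin_mem A rfl b
    have hιq : ∀ m ∈ A, ∃ a, a ≠ 0 ∧ ι a = m := by
      intro m hm
      have : m ∈ Set.range (A.orderEmbOfFin rfl) := by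
        rw [Finset.range_orderEmbOfFin]; exact hm
      obtain ⟨b, rfl⟩ := this
      exact ⟨b.succ, Fin.succ_ne_zero b, rfl⟩
    have hj : ∀ a, j (ι a) = i := by
      intro a
      by_cases ha : a = 0
      · rw [ha]; exact hA q (Finset.mem_insert_self ..)
      · exact hA _ (Finset.mem_insert_of_mem (hιA a ha))
    have hcard : A.card + 1 ≤ n := by
      simpa using Fintype.card_le_of_embedding ι
    have hu := (hΛ A.card hcard).2
    rw [← swaps_zero] at hu
    have hs : ∀ x, piOp (repOf M) i q e x ≠ 0 → x q = Sum.inl i := by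
      intro x hx
      by_contra h0
      exact hx (by rw [piOp_apply, if_neg h0])
    have hcyc : piOp (repOf M) i q e ∈ cycles (repOf M) ι (kerK g) j := by
      refine ⟨Graded.piOp he1 q, fun x => ?_, fun x hx => ?_, fun a => ?_⟩
      · change compOp i g (piOp (repOf M) i q e) x = 0
        -- The defect dies in N because its image is π_q `f`, and `f` belongs to F_i(N).
        rw [compOp_piOp, he3, hf.2.2, Pi.zero_apply]
      · have hxq := hs x hx
        rw [piOp_apply, if_pos hxq] at hx
        obtain ⟨r, -, hr⟩ := Finset.exists_ne_zero_of_sum_ne_zero hx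
        obtain ⟨hb, hc⟩ := he2 _ fun h0 => hr (by rw [h0, map_zero])
        -- Putting an edge at `q` leads into the support of `e`, where nothing is omitted; so `q = ι
        -- 0` is the one position omitted by `x`.
        refine ⟨?_, 0, fun m => ⟨fun hm => ?_, fun hm => ?_⟩⟩
        · rw [← hb, base_update, eq_comm, Function.update_eq_self_iff]
          simp [base, hxq]
        · by_contra hmq
          exact hc m (by rw [← hι0, Function.update_of_ne hmq, hm])
        · rw [hm]; exact hxq
      -- At `q` itself π_q π_q = 0: the outer map evaluates the inner one on configurations with an
      -- edge at `q`, where it is zero by definition. At the positions of `A`, the maps π commute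
      -- and the induction hypothesis applies.
      · by_cases ha : a = 0
        · subst ha
          rw [hι0]
          ext x
          by_cases hx : x q = Sum.inl i
          · rw [piOp_apply, if_pos hx]
            refine Finset.sum_eq_zero fun r _ => ?_
            rw [piOp_apply, if_neg (by simp), map_zero]
          · rw [piOp_apply, if_neg hx]; rfl
        · have hne : ι a ≠ q := fun h => hq (h ▸ hιA a ha)
          rw [piOp_comm _ (noLoop hi) hne, he4 _ (hιA a ha), map_zero]
    obtain ⟨e', h1, h2, h3, h4, h5⟩ := exists_piOp_eq (repOf M) (noLoop hi)
      (fun a v hv => by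
        change g (repOf M a v) = 0
        rw [map_repOf, show g v = 0 from hv, map_zero]) hj hu hcyc hs
    refine ⟨e - e', fun x => ?_, fun x hx => ?_, ?_, fun m hm => ?_⟩
    · rw [Pi.sub_apply, map_sub, he1 x, h1 x]
    · by_cases h0 : e x = 0
      · refine h3 x fun h0' => hx ?_
        rw [Pi.sub_apply, h0, h0', sub_zero]
      · exact he2 x h0
    · ext x
      rw [← he3, compOp_apply, compOp_apply, Pi.sub_apply, map_sub, show g (e' x) = 0 from h2 x,
        sub_zero]
    · rw [map_sub]
      rcases Finset.mem_insert.1 hm with rfl | hm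
      · rw [← hι0, h4, hι0, sub_self]
      · obtain ⟨a, ha, rfl⟩ := hιq m hm
        rw [h5 a ha, he4 _ hm, sub_zero]

/-- The lifting argument treats one tuple j at a time, with A = Δ(j). Since I^n is finite, an
element of F_i(N) is the sum of its projections, and the lifts of these are added up. -/
lemma reflMapK_surjective (hi : IsEmpty (i ⟶ i)) (hΛ : (lam, nu) ∈ genericSet (k := k) n i)
    (hg : Function.Surjective g) : Function.Surjective (reflMapK i g) := by
  have key : ∀ (j : Fin n → I) (f : reflection (repOf N) i),
      ∃ e : reflection (repOf M) i, (reflMapK i g e : Conf n i → N) = vtxOp k N i j f := by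
    intro j f
    obtain ⟨e, h1, h2, h3, h4⟩ := exists_lift_of_finset g hi hΛ hg (vtxOp_mem j f.2)
      (fun x hx => by rw [vtxOp_apply, if_neg hx]) {m | j m = i} (by simp)
    refine ⟨⟨e, h1, fun x ⟨m, hm⟩ => ?_, fun p => ?_⟩, h3⟩
    · by_contra h0
      exact (h2 x h0).2 m hm
    · by_cases hp : j p = i
      · exact h4 p (by simpa using hp)
      -- For p outside Δ(j) the map π_p annihilates `e` for free: it reads only configurations with
      -- an edge into `i` at `p`, and these do not lie over `j`.
      · ext x
        rw [piOp_apply]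
        split_ifs with hx
        · refine Finset.sum_eq_zero fun r _ => ?_
          rw [show e (Function.update x p (Sum.inr r)) = 0 from ?_, map_zero]
          by_contra h0
          refine hp ?_
          rw [← (h2 _ h0).1]
          simp [base]
        · rfl
  intro f
  choose e he using key
  refine ⟨∑ j, e j f, Subtype.ext ?_⟩
  rw [map_sum, AddSubmonoidClass.coe_finsetSum]
  simp only [he]
  ext x
  simp [vtxOp_apply]

lemma reflMapK_injective (hg : Function.Injective g) : Function.Injective (reflMapK i g) := by
  intro e f h
  refine Subtype.ext (funext fun x => hg ?_)
  exact congrFun (congrArg Subtype.val h) x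

/-- Preimages are chosen componentwise by exactness at M. All conditions defining F_i are equations
natural in the module, so the injective f reflects them and the family of preimages lies in F_i(P)
without further choices. -/
lemma reflMapK_exact {P : ModuleCat.{w} (Alg n lam nu)} (f : P →ₗ[Alg n lam nu] M)
    (hf : Function.Injective f) (hfg : Function.Exact f g) :
    Function.Exact (reflMapK i f) (reflMapK i g) := by
  intro e
  constructor
  · intro he
    have he' : ∀ x, g (e.1 x) = 0 := fun x => congrFun (congrArg Subtype.val he) x
    choose c hc using fun x => (hfg (e.1 x)).1 (he' x)
    have hc' : compOp i f c = e.1 := funext hc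
    obtain ⟨h1, h2, h3⟩ := e.2
    refine ⟨⟨c, fun x => hf ?_, fun x hx => hf ?_, fun p => funext fun x => hf ?_⟩,
      Subtype.ext hc'⟩
    · rw [map_repOf, hc, h1 x]
    · rw [hc, map_zero, h2 x hx]
    -- After applying `f`, the equation π_p `c` = 0 becomes π_p `e` = 0.
    · change compOp i f (piOp (repOf P) i p c) x = _
      rw [compOp_piOp, hc', h3]
      exact (map_zero f).symm
  · rintro ⟨c, rfl⟩
    refine Subtype.ext (funext fun x => ?_)
    exact (hfg _).2 ⟨c.1 x, rfl⟩

end Exactness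

instance {k : Type uk} [CommRing k] {I : Type u} [Quiver.{v} I] [Fintype I]
    [Fintype (Quiver.Total I)] (n : ℕ) (lam : I → k) (nu : k) (i : I) (hi : IsEmpty (i ⟶ i)) :
    (reflectionFunctor.{u, v, w, uk} n lam nu i hi).Additive where
  map_add := rfl

end

end WreathReflection

theorem corollary5p2 {k : Type uk} [CommRing k] {I : Type u} [Quiver.{v} I] [Fintype I]
    [Fintype (Quiver.Total I)] (n : ℕ) (hn : 0 < n) (i : I) (hi : IsEmpty (i ⟶ i))
    (lam : I → k) (nu : k) (hΛ : (lam, nu) ∈ WreathReflection.genericSet (k := k) n i) :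
    CategoryTheory.Limits.PreservesFiniteLimits
        (WreathReflection.reflectionFunctor.{u, v, w, uk} n lam nu i hi) ∧
      CategoryTheory.Limits.PreservesFiniteColimits
        (WreathReflection.reflectionFunctor.{u, v, w, uk} n lam nu i hi) := by
  -- For an additive functor between abelian categories, exactness in the sense of preserving finite
  -- limits and colimits may be tested on short exact sequences.
  refine ((WreathReflection.reflectionFunctor.{u, v, w, uk} n lam nu i hi).exact_tfae.out 0 3).1
    fun S hS => ?_
  have hinj := hS.moduleCat_injective_f
  have hsurj := hS.moduleCat_surjective_g
  have hex := (CategoryTheory.ShortComplex.ShortExact.moduleCat_exact_iff_function_exact S).1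
    hS.exact
  refine CategoryTheory.ShortComplex.ShortExact.mk' ?_ ?_ ?_
  · rw [CategoryTheory.ShortComplex.ShortExact.moduleCat_exact_iff_function_exact]
    exact WreathReflection.reflMapK_exact S.g.hom S.f.hom hinj hex
  · rw [ModuleCat.mono_iff_injective]
    exact WreathReflection.reflMapK_injective S.f.hom hinj
  · rw [ModuleCat.epi_iff_surjective]
    exact WreathReflection.reflMapK_surjective S.g.hom hi hΛ hsurj
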